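/- Let $\Gamma=(V,E,s,r)$ be a finite directed graph (finitely many vertices and edges; loops and multiple edges allowed) and let $F$ be a field. A path is a sequence $e_1\cdots e_n$ ($n\ge 1$) of edges with $r(e_i)=s(e_{i+1})$ for $i<n$; it starts at $s(e_1)$, ends at $r(e_n)$, and is closed if $r(e_n)=s(e_1)$. A cycle is the subgraph $(s(e_1),\dots,s(e_n);e_1,\dots,e_n)$ given by a closed path $e_1\cdots e_n$ with pairwise distinct vertices $s(e_1),\dots,s(e_n)$. The Leavitt path algebra $L(\Gamma)$ is the associative (not necessarily unital) $F$-algebra presented by generators $v\in V$ and $e,e^*$ ($e\in E$) and relations $vw=\delta_{v,w}v$; $s(e)e=er(e)=e$, $r(e)e^*=e^*s(e)=e^*$; $e^*f=\delta_{e,f}r(e)$; and $v=\sum_{s(e)=v}ee^*$ for every vertex $v$ that is the source of some edge. For a finite dimensional subspace $W$ generating a finitely generated algebra $A$, let $g_W(n)$ be the dimension of the span $W^n$ of all products of at least one and at most $n$ elements of $W$. For functions $f,g$ on $\{1,2,\dots\}$ write $f\preccurlyeq g$ if there is an integer $c\ge1$ with $f(n)\le c\,g(cn)$ for all $n\ge1$,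 and $f\sim g$ if $f\preccurlyeq g\preccurlyeq f$; up to $\sim$, $g_W$ does not depend on $W$. The growth of $A$ is polynomially bounded if $g_W\preccurlyeq n^d$ for some integer $d\ge0$, and exponential if $g_W\sim 2^n$; $\operatorname{GKdim}A=\limsup_{n\to\infty}\ln g_W(n)/\ln n$ (with $\operatorname{GKdim}0=0$). (1) $L(\Gamma)$ has polynomially bounded growth if and only if any two distinct cycles of $\Gamma$ have no common vertex. If some two distinct cycles have a common vertex, then $L(\Gamma)$ contains a free (non-unital associative) subalgebra on two generators and has exponential growth. (2) For cycles $C',C''$ write $C'\Rightarrow C''$ if some path starts at a vertex of $C'$ and ends at a vertex of $C''$. A chain of length $k$ is a sequence of distinct cycles $C_1\Rightarrow\cdots\Rightarrow C_k$; it has an exit if there is an edge $e$ that does not belong to $C_k$ and whose source $s(e)$ is a vertex of $C_k$. Let $d_1$ be the maximal length of a chain of cycles and $d_2$ the maximal length of a chain of cycles with an exit (a maximum over no chains being $0$). If any two distinct cycles of $\Gamma$ have no common vertex, then $$\operatorname{GKdim}L(\Gamma)=\max(2d_1-1,\,2d_2).$$ -/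

import Mathlib

/-- A directed graph `Γ = (V, E, s, r)`; loops and multiple edges are allowed. -/
structure DirGraph (V E : Type*) where
  /-- the source of an edge -/
  s : E → V
  /-- the range of an edge -/
  r : E → V

namespace DirGraph

variable {V E : Type*}

/-! ### Paths, cycles and chains of cycles -/

/-- `e₁ … eₙ` (with `n ≥ 1`) is a path if `r (eᵢ) = s (eᵢ₊₁)` for all `i < n`. -/
def IsPath (Γ : DirGraph V E) (p : List E) : Prop :=
  p ≠ [] ∧ p.IsChain (fun e f => Γ.r e = Γ.s f)

/-- The path `p` starts at the vertex `v`. -/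
def StartsAt (Γ : DirGraph V E) (p : List E) (v : V) : Prop :=
  ∃ e, p.head? = some e ∧ Γ.s e = v

/-- The path `p` ends at the vertex `v`. -/
def EndsAt (Γ : DirGraph V E) (p : List E) (v : V) : Prop :=
  ∃ e, p.getLast? = some e ∧ Γ.r e = v

/-- A closed path: it ends where it starts. -/
def IsClosedPath (Γ : DirGraph V E) (p : List E) : Prop :=
  Γ.IsPath p ∧ ∃ v, Γ.StartsAt p v ∧ Γ.EndsAt p v

/-- A cycle: the subgraph `(s e₁, …, s eₙ; e₁, …, eₙ)` formed by the edges of a closed path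
`e₁ … eₙ` whose sources are pairwise distinct. Closed paths that differ only in their starting
point give the same cycle. -/
@[ext]
structure Cycle (Γ : DirGraph V E) where
  /-- the vertices of the cycle -/
  verts : Set V
  /-- the edges of the cycle -/
  edges : Set E
  exists_path : ∃ p : List E, Γ.IsClosedPath p ∧ (p.map Γ.s).Nodup ∧
    verts = {v | v ∈ p.map Γ.s} ∧ edges = {e | e ∈ p}

/-- Any two distinct cycles of `Γ` have no common vertex. -/
def CyclesDisjoint (Γ : DirGraph V E) : Prop :=
  ∀ C D : Γ.Cycle, C ≠ D → Disjoint C.verts D.verts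

/-- `C ⟹ D`: some path starts in `C` and ends in `D`. -/
def Cycle.Reaches {Γ : DirGraph V E} (C D : Γ.Cycle) : Prop :=
  ∃ p : List E, Γ.IsPath p ∧ ∃ v ∈ C.verts, ∃ w ∈ D.verts, Γ.StartsAt p v ∧ Γ.EndsAt p w

/-- The cycle `C` has an exit: an edge that starts on `C` and does not belong to `C`. -/
def Cycle.HasExit {Γ : DirGraph V E} (C : Γ.Cycle) : Prop :=
  ∃ e : E, Γ.s e ∈ C.verts ∧ e ∉ C.edges

/-- A chain of cycles: distinct cycles `C₁ ⟹ ⋯ ⟹ Cₖ`; its length is `k`. -/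
def IsCycleChain (Γ : DirGraph V E) (l : List Γ.Cycle) : Prop :=
  l.Nodup ∧ l.IsChain Cycle.Reaches

/-- The chain `C₁ ⟹ ⋯ ⟹ Cₖ` has an exit: its last cycle `Cₖ` has an exit. -/
def ChainHasExit (Γ : DirGraph V E) (l : List Γ.Cycle) : Prop :=
  ∃ C, l.getLast? = some C ∧ C.HasExit

/-- The maximal length of a chain of cycles (`0` if there is no cycle). -/
noncomputable def maxChain (Γ : DirGraph V E) : ℕ :=
  sSup {k | ∃ l : List Γ.Cycle, Γ.IsCycleChain l ∧ l.length = k}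

/-- The maximal length of a chain of cycles with an exit (`0` if there is no such chain). -/
noncomputable def maxExitChain (Γ : DirGraph V E) : ℕ :=
  sSup {k | ∃ l : List Γ.Cycle, Γ.IsCycleChain l ∧ Γ.ChainHasExit l ∧ l.length = k}

/-! ### The Leavitt path algebra -/

/-- The generators `v`, `e`, `e*` of the Leavitt path algebra. -/
inductive Gen (V E : Type*)
  | vert (v : V) : Gen V E
  | edge (e : E) : Gen V E
  | ghost (e : E) : Gen V E

/-- The free associative (non-unital) `F`-algebra on the generators `v`, `e`, `e*`: the semigroup
algebra of the free semigroup of non-empty words. -/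
abbrev FreeAlg (F V E : Type*) [Field F] : Type _ :=
  MonoidAlgebra F (FreeSemigroup (Gen V E))

section Generators

variable (F : Type*) [Field F]

/-- The generator `v` in the free algebra. -/
noncomputable def fv (E : Type*) (v : V) : FreeAlg F V E :=
  MonoidAlgebra.single (FreeSemigroup.of (Gen.vert v)) 1

/-- The generator `e` in the free algebra. -/
noncomputable def fe (V : Type*) (e : E) : FreeAlg F V E :=
  MonoidAlgebra.single (FreeSemigroup.of (Gen.edge e)) 1

/-- The generator `e*` in the free algebra. -/
noncomputable def fs (V : Type*) (e : E) : FreeAlg F V E :=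
  MonoidAlgebra.single (FreeSemigroup.of (Gen.ghost e)) 1

/-- The relators of the Leavitt path algebra. In the last one, `S` is the set of all edges with
source `v`, which is required to be finite and non-empty. -/
inductive IsRelator (Γ : DirGraph V E) : FreeAlg F V E → Prop
  | vert_self (v : V) : IsRelator Γ (fv F E v * fv F E v - fv F E v)
  | vert_ne (v w : V) : v ≠ w → IsRelator Γ (fv F E v * fv F E w)
  | source_edge (e : E) : IsRelator Γ (fv F E (Γ.s e) * fe F V e - fe F V e)
  | edge_range (e : E) : IsRelator Γ (fe F V e * fv F E (Γ.r e) - fe F V e)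
  | range_ghost (e : E) : IsRelator Γ (fv F E (Γ.r e) * fs F V e - fs F V e)
  | ghost_source (e : E) : IsRelator Γ (fs F V e * fv F E (Γ.s e) - fs F V e)
  | ghost_edge_self (e : E) : IsRelator Γ (fs F V e * fe F V e - fv F E (Γ.r e))
  | ghost_edge_ne (e f : E) : e ≠ f → IsRelator Γ (fs F V e * fe F V f)
  | sum_edges (v : V) (S : Finset E) : S.Nonempty → (∀ e, e ∈ S ↔ Γ.s e = v) →
      IsRelator Γ (fv F E v - ∑ e ∈ S, fe F V e * fs F V e)

/-- The two-sided ideal of the free algebra generated by the relators: the smallest subspace that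
contains them and is stable under left and right multiplication. -/
noncomputable def relIdeal (Γ : DirGraph V E) : Submodule F (FreeAlg F V E) :=
  sInf {I | (∀ x, IsRelator F Γ x → x ∈ I) ∧ ∀ a, ∀ x ∈ I, a * x ∈ I ∧ x * a ∈ I}

theorem relIdeal_mul_left (Γ : DirGraph V E) (a x : FreeAlg F V E) (hx : x ∈ relIdeal F Γ) :
    a * x ∈ relIdeal F Γ := by
  simp only [relIdeal, Submodule.mem_sInf] at hx ⊢
  exact fun I hI => (hI.2 a x (hx I hI)).1

theorem relIdeal_mul_right (Γ : DirGraph V E) (a x : FreeAlg F V E) (hx : x ∈ relIdeal F Γ) :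
    x * a ∈ relIdeal F Γ := by
  simp only [relIdeal, Submodule.mem_sInf] at hx ⊢
  exact fun I hI => (hI.2 a x (hx I hI)).2

/-- The Leavitt path algebra `L(Γ)` over `F`: the associative `F`-algebra presented by the
generators `v`, `e`, `e*` and the relators above. -/
def Leavitt (Γ : DirGraph V E) : Type _ := FreeAlg F V E ⧸ relIdeal F Γ

namespace Leavitt

variable (Γ : DirGraph V E)

noncomputable instance : AddCommGroup (Leavitt F Γ) :=
  inferInstanceAs (AddCommGroup (FreeAlg F V E ⧸ relIdeal F Γ))

noncomputable instance : Module F (Leavitt F Γ) :=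
  inferInstanceAs (Module F (FreeAlg F V E ⧸ relIdeal F Γ))

/-- The projection from the free algebra onto the Leavitt path algebra. -/
noncomputable def mk : FreeAlg F V E →ₗ[F] Leavitt F Γ := (relIdeal F Γ).mkQ

theorem mk_surjective : Function.Surjective (mk F Γ) := (relIdeal F Γ).mkQ_surjective

theorem mk_eq_mk {x y : FreeAlg F V E} : mk F Γ x = mk F Γ y ↔ x - y ∈ relIdeal F Γ :=
  Submodule.Quotient.eq _

/-- Multiplication in the Leavitt path algebra, induced by that of the free algebra. -/
noncomputable instance : Mul (Leavitt F Γ) where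
  mul := Quotient.map₂ (· * ·) (by
    intro a a' ha b b' hb
    have ha' : a - a' ∈ relIdeal F Γ := (Submodule.quotientRel_def _).1 ha
    have hb' : b - b' ∈ relIdeal F Γ := (Submodule.quotientRel_def _).1 hb
    refine (Submodule.quotientRel_def _).2 ?_
    have h : a * b - a' * b' = (a - a') * b + a' * (b - b') := by
      rw [sub_mul, mul_sub]; abel
    rw [h]
    exact add_mem (relIdeal_mul_right F Γ _ _ ha') (relIdeal_mul_left F Γ _ _ hb'))

theorem mk_mul (x y : FreeAlg F V E) : mk F Γ (x * y) = mk F Γ x * mk F Γ y := rfl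

noncomputable instance : NonUnitalRing (Leavitt F Γ) :=
  { (inferInstance : AddCommGroup (Leavitt F Γ)), (inferInstance : Mul (Leavitt F Γ)) with
    left_distrib := fun a b c => by
      obtain ⟨a, rfl⟩ := mk_surjective F Γ a
      obtain ⟨b, rfl⟩ := mk_surjective F Γ b
      obtain ⟨c, rfl⟩ := mk_surjective F Γ c
      simp only [← map_add, ← mk_mul, mul_add]
    right_distrib := fun a b c => by
      obtain ⟨a, rfl⟩ := mk_surjective F Γ a
      obtain ⟨b, rfl⟩ := mk_surjective F Γ b
      obtain ⟨c, rfl⟩ := mk_surjective F Γ c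
      simp only [← map_add, ← mk_mul, add_mul]
    zero_mul := fun a => by
      obtain ⟨a, rfl⟩ := mk_surjective F Γ a
      rw [← map_zero (mk F Γ), ← mk_mul, zero_mul]
    mul_zero := fun a => by
      obtain ⟨a, rfl⟩ := mk_surjective F Γ a
      rw [← map_zero (mk F Γ), ← mk_mul, mul_zero]
    mul_assoc := fun a b c => by
      obtain ⟨a, rfl⟩ := mk_surjective F Γ a
      obtain ⟨b, rfl⟩ := mk_surjective F Γ b
      obtain ⟨c, rfl⟩ := mk_surjective F Γ c
      simp only [← mk_mul, mul_assoc] }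

instance : IsScalarTower F (Leavitt F Γ) (Leavitt F Γ) where
  smul_assoc c a b := by
    obtain ⟨a, rfl⟩ := mk_surjective F Γ a
    obtain ⟨b, rfl⟩ := mk_surjective F Γ b
    simp only [smul_eq_mul, ← map_smul, ← mk_mul, smul_mul_assoc]

instance : SMulCommClass F (Leavitt F Γ) (Leavitt F Γ) where
  smul_comm c a b := by
    obtain ⟨a, rfl⟩ := mk_surjective F Γ a
    obtain ⟨b, rfl⟩ := mk_surjective F Γ b
    simp only [smul_eq_mul, ← map_smul, ← mk_mul, mul_smul_comm]

end Leavitt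

end Generators

end DirGraph

/-! ### Growth of (not necessarily unital) associative algebras -/

section Growth

variable {F : Type*} [Field F] {A : Type*} [NonUnitalRing A] [Module F A]
  [IsScalarTower F A A] [SMulCommClass F A A]

/-- `Wⁿ`: the span of all products `w₁ ⋯ wₖ` with `1 ≤ k ≤ n` and `wᵢ ∈ W`. -/
noncomputable def wordSpan (W : Submodule F A) : ℕ → Submodule F A
  | 0 => ⊥
  | n + 1 => W ⊔ Submodule.map₂ (LinearMap.mul F A) W (wordSpan W n)

/-- The growth function `n ↦ dim Wⁿ`. -/
noncomputable def growth (W : Submodule F A) (n : ℕ) : ℝ :=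
  (Module.finrank F (wordSpan W n) : ℝ)

/-- `W` is a finite dimensional subspace that generates the algebra `A`. -/
def IsGenerating (W : Submodule F A) : Prop :=
  FiniteDimensional F W ∧ NonUnitalAlgebra.adjoin F (W : Set A) = ⊤

/-- `f ≼ g`: there is `c ∈ {1, 2, …}` with `f n ≤ c * g (c * n)` for all `n ≥ 1`. -/
def GrowthLE (f g : ℕ → ℝ) : Prop :=
  ∃ c : ℕ, 1 ≤ c ∧ ∀ n : ℕ, 1 ≤ n → f n ≤ c * g (c * n)

/-- `f ∼ g`: the functions `f` and `g` are asymptotically equivalent. -/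
def GrowthEquiv (f g : ℕ → ℝ) : Prop :=
  GrowthLE f g ∧ GrowthLE g f

variable (F A)

/-- The algebra `A` is finitely generated and its growth (with respect to any finite dimensional
generating subspace) is polynomially bounded. -/
def HasPolynomialGrowth : Prop :=
  (∃ W : Submodule F A, IsGenerating W) ∧
    ∀ W : Submodule F A, IsGenerating W → ∃ d : ℕ, GrowthLE (growth W) (fun n => (n : ℝ) ^ d)

/-- The algebra `A` is finitely generated and its growth (with respect to any finite dimensional
generating subspace) is exponential. -/
def HasExponentialGrowth : Prop :=
  (∃ W : Submodule F A, IsGenerating W) ∧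
    ∀ W : Submodule F A, IsGenerating W → GrowthEquiv (growth W) (fun n => (2 : ℝ) ^ n)

/-- The algebra `A` is finitely generated and its Gelfand-Kirillov dimension,
`limsup (ln (dim Wⁿ) / ln n)` for any finite dimensional generating subspace `W`, is `d`.
The limsup is taken in the extended reals, so it is `⊤` when the growth is not polynomially
bounded; since `Real.log 0 = 0`, the zero algebra has dimension `0`. -/
def HasGKDim (d : EReal) : Prop :=
  (∃ W : Submodule F A, IsGenerating W) ∧
    ∀ W : Submodule F A, IsGenerating W →
      Filter.limsup (fun n : ℕ => ((Real.log (growth W n) / Real.log n : ℝ) : EReal)) Filter.atTop = d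

/-- The algebra `A` contains a free (associative, non-unital) subalgebra on two generators: there
are `x 0, x 1 ∈ A` for which the canonical homomorphism from the free algebra on two generators
to `A` is injective. -/
def HasFreeSubalgebra : Prop :=
  ∃ x : Fin 2 → A,
    Function.Injective
      (MonoidAlgebra.liftMagma F (FreeSemigroup.lift x) :
        MonoidAlgebra F (FreeSemigroup (Fin 2)) →ₙₐ[F] A)

end Growth

/-! The monomials `p q*`, with `p` and `q` walks (possibly trivial) that end at the same vertex,
span the algebra. Multiplication is controlled by prefixes: `p* p` is the end vertex of `p`, and `p*
q = 0` as soon as `p` and `q` part ways at some edge. A representation graded by path length shows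
that a vertex is nonzero and independent of paths of positive length; with the prefix rule this
makes distinct paths from `v` to `v` linearly independent (`linearIndependent_path`).

If two distinct cycles share a vertex, they give two closed walks at that vertex, neither a prefix
of the other. Distinct words in them are then distinct closed walks, hence independent: a free
subalgebra and exponential growth (`hasFreeSubalgebra`).

Suppose now that the cycles are disjoint. A walk meets cycles in the order of a chain and cannot
come back to a cycle it has left, so the walks of length at most `n` to `v` number at most a
constant times `(n + 1) ^ k`, where `k` is the length of a chain of cycles reaching `v`
(`exists_chainBound`). Pairs `(p, q)` then give exponent `2 * k`, which is good enough if `k` is at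
most the maximal length of a chain with an exit. Otherwise the last cycle `C` of the chain has no
exit, `v` lies on `C`, and every edge `e` of `C` satisfies `e e* = s(e)`. Cancelling common last
edges leaves pairs in which `p` or `q` has no turns around `C`, which saves one power
(`exists_reducedPairs_bound`).

For the lower bound, the numbers of turns around the cycles of a chain parametrize pairwise
diverging walks (`Fan`). Sandwiching independent elements `b` between such walks as `p b q*` keeps
independence (`linearIndependent_mul`). A chain of length `k` with an exit gives `k` parameters on
each side. Without an exit only the first `k - 1` cycles count on each side, but `b` can run over
the powers of the last cycle: exponent `2 * (k - 1) + 1`. -/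

namespace DirGraph

variable {V E : Type*} {Γ : DirGraph V E}

/-! ### Walks, including the trivial ones -/

/-- `p` is a possibly empty path that leads from `u` to `v`. -/
def Walk (Γ : DirGraph V E) : V → List E → V → Prop
  | u, [], v => u = v
  | u, e :: p, v => Γ.s e = u ∧ Walk Γ (Γ.r e) p v

@[simp] theorem walk_nil {u v : V} : Γ.Walk u [] v ↔ u = v := Iff.rfl

@[simp] theorem walk_cons {u v : V} {e : E} {p : List E} :
    Γ.Walk u (e :: p) v ↔ Γ.s e = u ∧ Γ.Walk (Γ.r e) p v := Iff.rfl

theorem walk_append {u v : V} {p q : List E} :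
    Γ.Walk u (p ++ q) v ↔ ∃ w, Γ.Walk u p w ∧ Γ.Walk w q v := by
  induction p generalizing u with
  | nil => simp
  | cons e p ih => simp [ih, and_assoc]

theorem Walk.append {u v w : V} {p q : List E} (hp : Γ.Walk u p v) (hq : Γ.Walk v q w) :
    Γ.Walk u (p ++ q) w := walk_append.2 ⟨v, hp, hq⟩

theorem Walk.end_unique {u v w : V} {p : List E} (h : Γ.Walk u p v) (h' : Γ.Walk u p w) :
    v = w := by
  induction p generalizing u with
  | nil => exact h.symm.trans h'
  | cons e p ih => exact ih h.2 h'.2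

/-- A walk ending at `v` with last edge `e`. -/
theorem walk_concat {u v : V} {p : List E} {e : E} :
    Γ.Walk u (p ++ [e]) v ↔ Γ.Walk u p (Γ.s e) ∧ Γ.r e = v := by
  rw [walk_append]
  constructor
  · rintro ⟨w, h, h1, h2⟩
    exact ⟨h1 ▸ h, h2⟩
  · rintro ⟨h, h2⟩
    exact ⟨_, h, rfl, h2⟩

theorem walk_edge (e : E) : Γ.Walk (Γ.s e) [e] (Γ.r e) := ⟨rfl, rfl⟩

/-- Each range is the source of the next edge, so the two lists differ only at the ends. For a
closed walk, ranges and sources agree as multisets; hence a cycle has exactly one edge into each of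
its vertices. -/
theorem Walk.perm {u v : V} {p : List E} (h : Γ.Walk u p v) :
    (u :: p.map Γ.r).Perm (v :: p.map Γ.s) := by
  induction p generalizing u with
  | nil => simp [walk_nil.1 h]
  | cons e p ih =>
    have h1 := ih h.2
    simp only [List.map_cons]
    rw [h.1]
    exact (h1.cons u).trans (List.Perm.swap _ _ _)

theorem Walk.isPath {u v : V} {p : List E} (h : Γ.Walk u p v) (hp : p ≠ []) :
    Γ.IsPath p ∧ Γ.StartsAt p u ∧ Γ.EndsAt p v := by
  induction p generalizing u with
  | nil => exact absurd rfl hp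
  | cons e p ih =>
    cases p with
    | nil => exact ⟨⟨by simp, by simp⟩, ⟨e, by simp, h.1⟩, ⟨e, by simp, h.2⟩⟩
    | cons f p =>
      obtain ⟨⟨_, h1⟩, ⟨g, hg, hg'⟩, ⟨g', h3, h3'⟩⟩ := ih h.2 (by simp)
      refine ⟨⟨by simp, ?_⟩, ⟨e, by simp, h.1⟩, ⟨g', by simpa using h3, h3'⟩⟩
      simp only [List.isChain_cons_cons]
      simp only [List.head?_cons, Option.some.injEq] at hg
      exact ⟨by rw [hg, hg'], h1⟩

theorem IsPath.walk {u v : V} {p : List E} (h : Γ.IsPath p) (hu : Γ.StartsAt p u)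
    (hv : Γ.EndsAt p v) : Γ.Walk u p v := by
  induction p generalizing u with
  | nil => exact absurd rfl h.1
  | cons e p ih =>
    obtain ⟨f, hf, rfl⟩ := hu
    simp only [List.head?_cons, Option.some.injEq] at hf
    subst hf
    refine ⟨rfl, ?_⟩
    cases p with
    | nil =>
      obtain ⟨f, hf, rfl⟩ := hv
      simp only [List.getLast?_singleton, Option.some.injEq] at hf
      subst hf
      rfl
    | cons f p =>
      obtain ⟨_, h2⟩ := h
      rw [List.isChain_cons_cons] at h2
      obtain ⟨g, hg, hg'⟩ := hv
      exact ih ⟨by simp, h2.2⟩ ⟨f, by simp, h2.1.symm⟩ ⟨g, by simpa using hg, hg'⟩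

theorem Walk.exists_loop {u v : V} {p : List E} (h : Γ.Walk u p v)
    (hp : ¬ (p.map Γ.s).Nodup) :
    ∃ a b c x, p = a ++ b ++ c ∧ b ≠ [] ∧ c ≠ [] ∧ Γ.Walk u a x ∧ Γ.Walk x b x ∧
      Γ.Walk x c v := by
  induction p generalizing u with
  | nil => simp at hp
  | cons e p ih =>
    by_cases he : Γ.s e ∈ p.map Γ.s
    · obtain ⟨f, hf, hfe⟩ := List.mem_map.1 he
      obtain ⟨l, m, rfl⟩ := List.append_of_mem hf
      obtain ⟨w, h1, h2⟩ := walk_append.1 h.2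
      refine ⟨[], e :: l, f :: m, u, by simp, by simp, by simp, rfl, ⟨h.1, ?_⟩, ?_⟩
      · rw [← h.1, ← hfe, h2.1]; exact h1
      · rw [← h.1, ← hfe, h2.1]; exact h2
    · have hp' : ¬ (p.map Γ.s).Nodup := fun h' => hp (by simpa using ⟨by simpa using he, h'⟩)
      obtain ⟨a, b, c, x, rfl, hb, hc, h1, h2, h3⟩ := ih h.2 hp'
      exact ⟨e :: a, b, c, x, by simp, hb, hc, ⟨h.1, h1⟩, h2, h3⟩

/-! ### Cycles -/

theorem Cycle.exists_walk (C : Γ.Cycle) {v : V} (hv : v ∈ C.verts) :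
    ∃ p, p ≠ [] ∧ Γ.Walk v p v ∧ (p.map Γ.s).Nodup ∧ C.verts = {v | v ∈ p.map Γ.s} ∧
      C.edges = {e | e ∈ p} := by
  obtain ⟨p, ⟨hp, u, hu, hu'⟩, hnd, hV, hE⟩ := C.exists_path
  have hw := hp.walk hu hu'
  rw [hV] at hv
  obtain ⟨e, he, rfl⟩ := List.mem_map.1 hv
  obtain ⟨l, m, rfl⟩ := List.append_of_mem he
  obtain ⟨w, h1, h2⟩ := walk_append.1 hw
  have hperm : (l ++ e :: m).Perm (e :: m ++ l) := List.perm_append_comm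
  refine ⟨e :: m ++ l, by simp, Walk.append (v := u) ⟨rfl, h2.2⟩ (h2.1 ▸ h1), ?_, ?_, ?_⟩
  · exact ((hperm.map Γ.s).nodup_iff).1 hnd
  · rw [hV]; ext x; exact (hperm.map Γ.s).mem_iff
  · rw [hE]; ext x; exact hperm.mem_iff

theorem Walk.exists_cycle {v : V} {p : List E} (h : Γ.Walk v p v) (hp : p ≠ [])
    (hnd : (p.map Γ.s).Nodup) :
    ∃ C : Γ.Cycle, C.verts = {v | v ∈ p.map Γ.s} ∧ C.edges = {e | e ∈ p} := by
  obtain ⟨h1, h2, h3⟩ := h.isPath hp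
  exact ⟨⟨_, _, p, ⟨h1, v, h2, h3⟩, hnd, rfl, rfl⟩, rfl, rfl⟩

theorem Cycle.source_mem (C : Γ.Cycle) {e : E} (he : e ∈ C.edges) : Γ.s e ∈ C.verts := by
  obtain ⟨p, -, -, hV, hE⟩ := C.exists_path
  rw [hE] at he
  rw [hV]
  exact List.mem_map_of_mem (f := Γ.s) he

theorem Cycle.verts_nonempty (C : Γ.Cycle) : C.verts.Nonempty := by
  obtain ⟨p, ⟨⟨hp, -⟩, -⟩, -, hV, -⟩ := C.exists_path
  obtain ⟨e, p, rfl⟩ := List.exists_cons_of_ne_nil hp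
  exact ⟨Γ.s e, by rw [hV]; simp⟩

theorem Cycle.range_mem (C : Γ.Cycle) {e : E} (he : e ∈ C.edges) : Γ.r e ∈ C.verts := by
  obtain ⟨p, -, hw, -, hV, hE⟩ := C.exists_walk (C.source_mem he)
  have h := (List.perm_cons _).1 hw.perm
  rw [hE] at he
  rw [hV]
  exact h.mem_iff.1 (List.mem_map_of_mem (f := Γ.r) he)

theorem Cycle.eq_of_source_eq (C : Γ.Cycle) {e f : E} (he : e ∈ C.edges) (hf : f ∈ C.edges)
    (h : Γ.s e = Γ.s f) : e = f := by
  obtain ⟨p, -, hnd, -, hE⟩ := C.exists_path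
  rw [hE] at he hf
  exact List.inj_on_of_nodup_map hnd he hf h

theorem Cycle.eq_of_range_eq (C : Γ.Cycle) {e f : E} (he : e ∈ C.edges) (hf : f ∈ C.edges)
    (h : Γ.r e = Γ.r f) : e = f := by
  obtain ⟨p, -, hw, hnd, -, hE⟩ := C.exists_walk (C.source_mem he)
  have hperm := (List.perm_cons _).1 hw.perm
  rw [hE] at he hf
  exact List.inj_on_of_nodup_map (hperm.nodup_iff.2 hnd) he hf h

/-- `v` can be reached from `u`, possibly by the trivial path. -/
def Reach (Γ : DirGraph V E) (u v : V) : Prop := ∃ p, Γ.Walk u p v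

theorem Reach.refl (v : V) : Γ.Reach v v := ⟨[], rfl⟩

theorem Reach.trans {u v w : V} (h : Γ.Reach u v) (h' : Γ.Reach v w) : Γ.Reach u w := by
  obtain ⟨p, hp⟩ := h
  obtain ⟨q, hq⟩ := h'
  exact ⟨_, hp.append hq⟩

theorem Reach.of_edge (e : E) : Γ.Reach (Γ.s e) (Γ.r e) := ⟨[e], rfl, rfl⟩

theorem Cycle.reach (C : Γ.Cycle) {u v : V} (hu : u ∈ C.verts) (hv : v ∈ C.verts) :
    Γ.Reach u v := by
  obtain ⟨p, -, hw, -, hV, -⟩ := C.exists_walk hu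
  rw [hV] at hv
  obtain ⟨e, he, rfl⟩ := List.mem_map.1 hv
  obtain ⟨l, m, rfl⟩ := List.append_of_mem he
  obtain ⟨w, h1, h2⟩ := walk_append.1 hw
  exact ⟨l, h2.1 ▸ h1⟩

/-- A vertex on a closed path lies on a cycle. -/
theorem Walk.exists_cycle_mem {v : V} {p : List E} (h : Γ.Walk v p v) (hp : p ≠ []) :
    ∃ C : Γ.Cycle, v ∈ C.verts := by
  induction hn : p.length using Nat.strong_induction_on generalizing p with
  | _ n ih =>
    by_cases hnd : (p.map Γ.s).Nodup
    · obtain ⟨C, hV, -⟩ := h.exists_cycle hp hnd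
      obtain ⟨e, p, rfl⟩ := List.exists_cons_of_ne_nil hp
      exact ⟨C, by rw [hV]; simp [h.1]⟩
    · obtain ⟨a, b, c, x, rfl, hb, hc, h1, h2, h3⟩ := h.exists_loop hnd
      refine ih (a ++ c).length ?_ (h1.append h3) (by simp [hc]) rfl
      have := List.length_pos_iff.2 hb
      simp only [List.length_append] at hn ⊢
      omega

theorem CyclesDisjoint.eq (hΓ : Γ.CyclesDisjoint) {C D : Γ.Cycle} {v : V} (hC : v ∈ C.verts)
    (hD : v ∈ D.verts) : C = D := by
  by_contra h
  exact Set.disjoint_left.1 (hΓ C D h) hC hD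

/-- A closed walk without repeated sources is a cycle through `v`, hence `C`. Otherwise an inner
loop is cut out; the remaining closed walk is shorter, so it lies on `C`, and therefore the loop is
based on `C` and is shorter too. -/
theorem CyclesDisjoint.mem_edges_of_closed (hΓ : Γ.CyclesDisjoint) {C : Γ.Cycle} {v : V}
    (hv : v ∈ C.verts) {p : List E} (h : Γ.Walk v p v) : ∀ e ∈ p, e ∈ C.edges := by
  induction hn : p.length using Nat.strong_induction_on generalizing p v with
  | _ n ih =>
    by_cases hp : p = []
    · simp [hp]
    by_cases hnd : (p.map Γ.s).Nodup
    · obtain ⟨D, hV, hE⟩ := h.exists_cycle hp hnd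
      have hD : v ∈ D.verts := by
        obtain ⟨e, p, rfl⟩ := List.exists_cons_of_ne_nil hp
        rw [hV]; simp [h.1]
      rw [hΓ.eq hv hD, hE]
      exact fun e he => he
    · obtain ⟨a, b, c, x, rfl, hb, hc, h1, h2, h3⟩ := h.exists_loop hnd
      have hb' := List.length_pos_iff.2 hb
      have hc' := List.length_pos_iff.2 hc
      have hac : ∀ e ∈ a ++ c, e ∈ C.edges := by
        refine ih (a ++ c).length ?_ hv (h1.append h3) rfl
        simp only [List.length_append] at hn ⊢
        omega
      have hx : x ∈ C.verts := by
        obtain ⟨e, c, rfl⟩ := List.exists_cons_of_ne_nil hc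
        rw [← h3.1]
        exact C.source_mem (hac e (by simp))
      have hbC : ∀ e ∈ b, e ∈ C.edges := by
        refine ih b.length ?_ hx h2 rfl
        simp only [List.length_append] at hn
        omega
      intro e he
      simp only [List.mem_append] at he hac
      rcases he with (he | he) | he
      · exact hac e (Or.inl he)
      · exact hbC e he
      · exact hac e (Or.inr he)

/-- A walk from `C` that can still return to `C` extends to a closed walk: once a cycle is left, it
is never reached again. -/
theorem CyclesDisjoint.mem_edges (hΓ : Γ.CyclesDisjoint) {C : Γ.Cycle} {u v w : V}
    (hu : u ∈ C.verts) (hw : w ∈ C.verts) {p : List E} (h : Γ.Walk u p v) (hvw : Γ.Reach v w) :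
    ∀ e ∈ p, e ∈ C.edges := by
  obtain ⟨q, hq⟩ := hvw.trans (C.reach hw hu)
  intro e he
  exact hΓ.mem_edges_of_closed hu (h.append hq) e (by simp [he])

theorem CyclesDisjoint.mem_verts (hΓ : Γ.CyclesDisjoint) {C : Γ.Cycle} {u v w : V}
    (hu : u ∈ C.verts) (hw : w ∈ C.verts) (huv : Γ.Reach u v) (hvw : Γ.Reach v w) :
    v ∈ C.verts := by
  obtain ⟨p, h⟩ := huv
  have hp := hΓ.mem_edges hu hw h hvw
  rcases List.eq_nil_or_concat' p with rfl | ⟨q, e, rfl⟩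
  · exact h ▸ hu
  · rw [← (walk_concat.1 h).2]
    exact C.range_mem (hp e (by simp))

theorem Cycle.Reaches.exists_reach {C D : Γ.Cycle} (h : C.Reaches D) :
    ∃ v ∈ C.verts, ∃ w ∈ D.verts, Γ.Reach v w := by
  obtain ⟨p, hp, v, hv, w, hw, h1, h2⟩ := h
  exact ⟨v, hv, w, hw, p, hp.walk h1 h2⟩

theorem CyclesDisjoint.reaches (hΓ : Γ.CyclesDisjoint) {C D : Γ.Cycle} (hCD : C ≠ D) {u v : V}
    (hu : u ∈ C.verts) (hv : v ∈ D.verts) (h : Γ.Reach u v) : C.Reaches D := by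
  obtain ⟨p, hp⟩ := h
  have hne : p ≠ [] := by
    rintro rfl
    exact hCD (hΓ.eq hu (hp ▸ hv))
  obtain ⟨h1, h2, h3⟩ := hp.isPath hne
  exact ⟨p, h1, u, hu, v, hv, h2, h3⟩

/-! ### Chains of cycles -/

instance [Finite V] [Finite E] : Finite Γ.Cycle :=
  Finite.of_injective (fun C => (C.verts, C.edges)) fun _ _ h =>
    Cycle.ext (congrArg Prod.fst h) (congrArg Prod.snd h)

/-- `sSup` on `ℕ` is a genuine maximum only for bounded nonempty sets; the bound comes from the
finiteness of the set of cycles. -/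
theorem bddAbove_chainLength [Finite V] [Finite E] (P : List Γ.Cycle → Prop) :
    BddAbove {k | ∃ l : List Γ.Cycle, Γ.IsCycleChain l ∧ P l ∧ l.length = k} := by
  have := Fintype.ofFinite Γ.Cycle
  refine ⟨Fintype.card Γ.Cycle, ?_⟩
  rintro k ⟨l, hl, -, rfl⟩
  exact hl.1.length_le_card

theorem IsCycleChain.length_le [Finite V] [Finite E] {l : List Γ.Cycle} (hl : Γ.IsCycleChain l) :
    l.length ≤ Γ.maxChain :=
  le_csSup (by simpa using bddAbove_chainLength (Γ := Γ) fun _ => True) ⟨l, hl, rfl⟩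

theorem IsCycleChain.length_le_of_exit [Finite V] [Finite E] {l : List Γ.Cycle}
    (hl : Γ.IsCycleChain l) (hx : Γ.ChainHasExit l) : l.length ≤ Γ.maxExitChain :=
  le_csSup (bddAbove_chainLength _) ⟨l, hl, hx, rfl⟩

theorem exists_maxChain [Finite V] [Finite E] (Γ : DirGraph V E) :
    ∃ l : List Γ.Cycle, Γ.IsCycleChain l ∧ l.length = Γ.maxChain :=
  Nat.sSup_mem (s := {k | ∃ l : List Γ.Cycle, Γ.IsCycleChain l ∧ l.length = k})
    ⟨0, [], ⟨by simp, by simp⟩, rfl⟩ (by simpa using bddAbove_chainLength (Γ := Γ) fun _ => True)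

/-- The value `0` is excluded because it is only the default for the empty set: the empty chain has
no last cycle, hence no exit. -/
theorem exists_maxExitChain [Finite V] [Finite E] (Γ : DirGraph V E) (h : Γ.maxExitChain ≠ 0) :
    ∃ l : List Γ.Cycle, Γ.IsCycleChain l ∧ Γ.ChainHasExit l ∧ l.length = Γ.maxExitChain := by
  refine Nat.sSup_mem (s := {k | ∃ l : List Γ.Cycle, Γ.IsCycleChain l ∧ Γ.ChainHasExit l ∧
    l.length = k}) ?_ (bddAbove_chainLength _)
  by_contra he
  rw [Set.not_nonempty_iff_eq_empty] at he
  apply h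
  rw [maxExitChain, he]
  simp

theorem maxExitChain_le_maxChain [Finite V] [Finite E] (Γ : DirGraph V E) :
    Γ.maxExitChain ≤ Γ.maxChain := by
  by_cases h : Γ.maxExitChain = 0
  · simp [h]
  · obtain ⟨l, hl, -, h⟩ := Γ.exists_maxExitChain h
    exact h ▸ hl.length_le

/-! ### Diverging walks -/

/-- These are the three behaviours of the product `p* q` for walks with the same start: a path, a
ghost path, or zero. -/
theorem exists_diverge (p q : List E) :
    (∃ r, q = p ++ r) ∨ (∃ r, p = q ++ r) ∨
      ∃ (a : List E) (e f : E) (b c : List E), e ≠ f ∧ p = a ++ e :: b ∧ q = a ++ f :: c := by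
  induction p generalizing q with
  | nil => exact Or.inl ⟨q, rfl⟩
  | cons e p ih =>
    cases q with
    | nil => exact Or.inr (Or.inl ⟨e :: p, rfl⟩)
    | cons f q =>
      by_cases hef : e = f
      · subst hef
        rcases ih q with ⟨r, rfl⟩ | ⟨r, rfl⟩ | ⟨a, x, y, b, c, hxy, rfl, rfl⟩
        · exact Or.inl ⟨r, rfl⟩
        · exact Or.inr (Or.inl ⟨r, rfl⟩)
        · exact Or.inr (Or.inr ⟨e :: a, x, y, b, c, hxy, rfl, rfl⟩)
      · exact Or.inr (Or.inr ⟨[], e, f, p, q, hef, rfl, rfl⟩)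

/-- Two distinct cycles with a common vertex yield two diverging closed walks. -/
theorem exists_closed_walks (hΓ : ¬ Γ.CyclesDisjoint) :
    ∃ (v : V) (a : List E) (e f : E) (b c : List E), e ≠ f ∧ Γ.Walk v (a ++ e :: b) v ∧
      Γ.Walk v (a ++ f :: c) v := by
  simp only [CyclesDisjoint, not_forall] at hΓ
  obtain ⟨C, D, hCD, h⟩ := hΓ
  obtain ⟨v, hC, hD⟩ := Set.not_disjoint_iff.1 h
  obtain ⟨p, hp, hpw, hpn, hpV, hpE⟩ := C.exists_walk hC
  obtain ⟨q, hq, hqw, hqn, hqV, hqE⟩ := D.exists_walk hD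
  -- A simple closed walk returns to `v` only at its end, so neither closed walk is a proper prefix
  -- of the other.
  have key : ∀ p r : List E, p ≠ [] → Γ.Walk v p v → ((p ++ r).map Γ.s).Nodup →
      Γ.Walk v (p ++ r) v → r = [] := by
    intro p r hp hpw hnd hw
    by_contra hr
    obtain ⟨e, p, rfl⟩ := List.exists_cons_of_ne_nil hp
    obtain ⟨f, r, rfl⟩ := List.exists_cons_of_ne_nil hr
    obtain ⟨w, h1, h2⟩ := walk_append.1 hw
    have hvw := hpw.end_unique h1
    subst hvw
    have : Γ.s e = Γ.s f := hpw.1.trans h2.1.symm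
    simp [this] at hnd
  have hne : p ≠ q := by
    rintro rfl
    exact hCD (Cycle.ext (hpV.trans hqV.symm) (hpE.trans hqE.symm))
  rcases exists_diverge p q with ⟨r, rfl⟩ | ⟨r, rfl⟩ | ⟨a, e, f, b, c, hef, rfl, rfl⟩
  · exact absurd (by simp [key p r hp hpw hqn hqw]) hne
  · exact absurd (by simp [key q r hq hqw hpn hpw]) hne
  · exact ⟨v, a, e, f, b, c, hef, hpw, hqw⟩

end DirGraph

/-! ### Generalities on growth -/

section GrowthLemmas

variable {F : Type*} [Field F] {A : Type*} [NonUnitalRing A] [Module F A]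
  [IsScalarTower F A A] [SMulCommClass F A A] {W W' : Submodule F A}

theorem wordSpan_succ (W : Submodule F A) (n : ℕ) :
    wordSpan W (n + 1) = W ⊔ Submodule.map₂ (LinearMap.mul F A) W (wordSpan W n) := rfl

theorem wordSpan_mono (W : Submodule F A) : Monotone (wordSpan W) := by
  refine monotone_nat_of_le_succ fun n => ?_
  induction n with
  | zero => exact bot_le
  | succ n ih => exact sup_le_sup_left (Submodule.map₂_le_map₂_right ih) W

theorem le_wordSpan {n : ℕ} (hn : 1 ≤ n) : W ≤ wordSpan W n :=
  le_sup_left.trans (wordSpan_mono W (show 0 + 1 ≤ n from hn))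

theorem mul_mem_wordSpan {m n : ℕ} {a b : A} (ha : a ∈ wordSpan W m) (hb : b ∈ wordSpan W n) :
    a * b ∈ wordSpan W (m + n) := by
  induction m generalizing a with
  | zero =>
    have : a = 0 := (Submodule.mem_bot F).1 ha
    simp [this]
  | succ m ih =>
    obtain ⟨x, hx, y, hy, rfl⟩ := Submodule.mem_sup.1 (wordSpan_succ W m ▸ ha)
    have hmn : m + 1 + n = (m + n) + 1 := by omega
    rw [add_mul]
    refine add_mem ?_ ?_
    · rw [hmn, wordSpan_succ]
      exact Submodule.mem_sup_right (Submodule.apply_mem_map₂ _ hx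
        (wordSpan_mono W (Nat.le_add_left n m) hb))
    · clear ha
      have hle : Submodule.map₂ (LinearMap.mul F A) W (wordSpan W m) ≤
          (wordSpan W (m + 1 + n)).comap (LinearMap.mulRight F b) := by
        rw [Submodule.map₂_le]
        intro w hw z hz
        rw [Submodule.mem_comap, hmn, wordSpan_succ]
        simp only [LinearMap.mul_apply', LinearMap.mulRight_apply, mul_assoc]
        exact Submodule.mem_sup_right (Submodule.apply_mem_map₂ (LinearMap.mul F A) hw (ih hz))
      exact hle hy

theorem wordSpan_le_wordSpan_mul {m : ℕ} (h : W' ≤ wordSpan W m) (n : ℕ) :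
    wordSpan W' n ≤ wordSpan W (m * n) := by
  induction n with
  | zero => exact bot_le
  | succ n ih =>
    rw [wordSpan_succ]
    refine sup_le (h.trans (wordSpan_mono W (Nat.le_mul_of_pos_right m n.succ_pos))) ?_
    rw [Submodule.map₂_le]
    intro x hx y hy
    rw [Nat.mul_succ, add_comm]
    exact mul_mem_wordSpan (h hx) (ih hy)

instance wordSpan_finiteDimensional [FiniteDimensional F W] (n : ℕ) :
    FiniteDimensional F (wordSpan W n) := by
  have hW : W.FG := Module.Finite.iff_fg.1 inferInstance
  refine Module.Finite.iff_fg.2 ?_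
  induction n with
  | zero => exact Submodule.fg_bot
  | succ n ih => exact hW.sup (hW.map₂ _ ih)

theorem IsGenerating.exists_mem_wordSpan (hW : IsGenerating W) (a : A) :
    ∃ n, a ∈ wordSpan W n := by
  have ha : a ∈ NonUnitalAlgebra.adjoin F (W : Set A) := by rw [hW.2]; trivial
  induction ha using NonUnitalAlgebra.adjoin_induction with
  | mem x hx => exact ⟨1, le_wordSpan le_rfl hx⟩
  | add x y _ _ hx hy =>
    obtain ⟨m, hm⟩ := hx
    obtain ⟨n, hn⟩ := hy
    exact ⟨max m n, add_mem (wordSpan_mono W (le_max_left m n) hm)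
      (wordSpan_mono W (le_max_right m n) hn)⟩
  | zero => exact ⟨0, zero_mem _⟩
  | mul x y _ _ hx hy =>
    obtain ⟨_, hm⟩ := hx
    obtain ⟨_, hn⟩ := hy
    exact ⟨_, mul_mem_wordSpan hm hn⟩
  | smul r x _ hx =>
    obtain ⟨m, hm⟩ := hx
    exact ⟨m, Submodule.smul_mem _ r hm⟩

theorem IsGenerating.exists_le_wordSpan (hW : IsGenerating W) [FiniteDimensional F W'] :
    ∃ m, 1 ≤ m ∧ W' ≤ wordSpan W m := by
  obtain ⟨S, rfl⟩ : W'.FG := Module.Finite.iff_fg.1 inferInstance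
  choose n hn using hW.exists_mem_wordSpan
  refine ⟨S.sup n + 1, by omega, Submodule.span_le.2 fun x hx => ?_⟩
  exact wordSpan_mono W ((Finset.le_sup (f := n) hx).trans (Nat.le_succ _)) (hn x)

theorem growth_mono [FiniteDimensional F W] : Monotone (growth W) := fun _ _ h =>
  Nat.cast_le.2 (Submodule.finrank_mono (wordSpan_mono W h))

theorem IsGenerating.exists_growth_le (hW : IsGenerating W) [FiniteDimensional F W'] :
    ∃ m, 1 ≤ m ∧ ∀ n, growth W' n ≤ growth W (m * n) := by
  have := hW.1
  obtain ⟨m, hm, h⟩ := hW.exists_le_wordSpan (W' := W')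
  exact ⟨m, hm, fun n => Nat.cast_le.2 (Submodule.finrank_mono (wordSpan_le_wordSpan_mul h n))⟩

theorem finrank_map₂_le {F M : Type*} [Field F] [AddCommGroup M] [Module F M]
    (f : M →ₗ[F] M →ₗ[F] M) (p q : Submodule F M) [FiniteDimensional F p]
    [FiniteDimensional F q] :
    Module.finrank F (Submodule.map₂ f p q) ≤ Module.finrank F p * Module.finrank F q := by
  classical
  have hb := Module.finBasis F p
  have hc := Module.finBasis F q
  have hp : p = Submodule.span F (Set.range fun i => (hb i : M)) := by
    have := congrArg (Submodule.map p.subtype) hb.span_eq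
    rw [Submodule.map_span, ← Set.range_comp, Submodule.map_top, Submodule.range_subtype] at this
    exact this.symm
  have hq : q = Submodule.span F (Set.range fun i => (hc i : M)) := by
    have := congrArg (Submodule.map q.subtype) hc.span_eq
    rw [Submodule.map_span, ← Set.range_comp, Submodule.map_top, Submodule.range_subtype] at this
    exact this.symm
  have h : Submodule.map₂ f p q = Submodule.span F
      (Set.range fun ij : Fin (Module.finrank F p) × Fin (Module.finrank F q) =>
        f (hb ij.1) (hc ij.2)) := by
    conv_lhs => rw [hp, hq]
    rw [Submodule.map₂_span_span]
    congr 1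
    ext x
    simp [Set.mem_image2]
  rw [h]
  refine (finrank_range_le_card _).trans ?_
  simp

/-- With `d = dim W` and `D = dim Wⁿ`, the recursive bound is `d + d * D`. Adding `1` to the
dimensions makes it multiplicative, since `d + d * D + 1 ≤ (d + 1) * (D + 1)`. -/
theorem finrank_wordSpan_le [FiniteDimensional F W] (n : ℕ) :
    Module.finrank F (wordSpan W n) + 1 ≤ (Module.finrank F W + 1) ^ n := by
  induction n with
  | zero =>
    show Module.finrank F (⊥ : Submodule F A) + 1 ≤ _
    simp
  | succ n ih =>
    have : FiniteDimensional F (Submodule.map₂ (LinearMap.mul F A) W (wordSpan W n)) :=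
      Submodule.finiteDimensional_of_le (S₂ := wordSpan W (n + 1)) le_sup_right
    have h1 := Submodule.finrank_add_le_finrank_add_finrank W
      (Submodule.map₂ (LinearMap.mul F A) W (wordSpan W n))
    have h2 := finrank_map₂_le (LinearMap.mul F A) W (wordSpan W n)
    rw [wordSpan_succ, pow_succ]
    calc _ ≤ (Module.finrank F (wordSpan W n) + 1) * (Module.finrank F W + 1) := by
          nlinarith
      _ ≤ _ := Nat.mul_le_mul_right _ ih

/-! ### Exponential growth -/

theorem growthLE_two_pow [FiniteDimensional F W] :
    GrowthLE (growth W) (fun n => (2 : ℝ) ^ n) := by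
  refine ⟨Module.finrank F W + 1, by omega, fun n _ => ?_⟩
  have h1 : Module.finrank F (wordSpan W n) ≤ 2 ^ ((Module.finrank F W + 1) * n) := by
    refine (Nat.le_succ _).trans ((finrank_wordSpan_le n).trans ?_)
    rw [pow_mul]
    exact Nat.pow_le_pow_left (Nat.lt_two_pow_self).le n
  have h2 : growth W n ≤ (2 : ℝ) ^ ((Module.finrank F W + 1) * n) := by
    have := (Nat.cast_le (α := ℝ)).2 h1
    simpa [growth] using this
  refine h2.trans (le_mul_of_one_le_left (by positivity) ?_)
  push_cast
  exact le_add_of_nonneg_left (Nat.cast_nonneg _)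

/-- The homomorphism sends a formal combination of words to the same combination of their images, so
freeness is linear independence of the words. -/
theorem liftMagma_injective_iff {M : Type*} [Mul M] {f : M →ₙ* A} :
    Function.Injective (MonoidAlgebra.liftMagma F f : MonoidAlgebra F M →ₙₐ[F] A) ↔
      LinearIndependent F f := by
  have h : (MonoidAlgebra.liftMagma F f : MonoidAlgebra F M → A) =
      Finsupp.linearCombination F f ∘ MonoidAlgebra.coeffAddEquiv := rfl
  rw [LinearIndependent, h, EquivLike.injective_comp]

theorem HasFreeSubalgebra.two_pow_growthLE (h : HasFreeSubalgebra F A) (hW : IsGenerating W) :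
    GrowthLE (fun n => (2 : ℝ) ^ n) (growth W) := by
  have := hW.1
  obtain ⟨x, hx⟩ := h
  have := FiniteDimensional.span_of_finite F (Set.finite_range x)
  obtain ⟨m, hm, hle⟩ := hW.exists_le_wordSpan (W' := Submodule.span F (Set.range x))
  have hxm : ∀ i, x i ∈ wordSpan W m := fun i => hle (Submodule.subset_span ⟨i, rfl⟩)
  have hword : ∀ (t : List (Fin 2)) (i : Fin 2),
      FreeSemigroup.lift x ⟨i, t⟩ ∈ wordSpan W (m * (t.length + 1)) := by
    intro t
    induction t with
    | nil =>
      intro i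
      have : (⟨i, []⟩ : FreeSemigroup (Fin 2)) = FreeSemigroup.of i := rfl
      simpa [this] using hxm i
    | cons j t ih =>
      intro i
      have : (⟨i, j :: t⟩ : FreeSemigroup (Fin 2)) = FreeSemigroup.of i * ⟨j, t⟩ := rfl
      rw [this, map_mul, FreeSemigroup.lift_of, List.length_cons, Nat.mul_succ, add_comm]
      exact mul_mem_wordSpan (hxm i) (ih j)
  refine ⟨m, hm, fun n hn => ?_⟩
  obtain ⟨k, rfl⟩ : ∃ k, n = k + 1 := ⟨n - 1, by omega⟩
  -- The words of length exactly `n = k + 1` already supply `2 ^ n` independent elements of `W ^ (m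
  -- * n)`.
  let w : (Fin (k + 1) → Fin 2) → FreeSemigroup (Fin 2) :=
    fun f => ⟨f 0, List.ofFn fun i : Fin k => f i.succ⟩
  have hw : Function.Injective w := by
    intro f g hfg
    simp only [w, FreeSemigroup.mk.injEq, List.ofFn_inj] at hfg
    funext i
    refine Fin.cases hfg.1 (fun j => congrFun hfg.2 j) i
  have hli := liftMagma_injective_iff.1 hx
  have hli' := hli.comp w hw
  have hmem : ∀ f, FreeSemigroup.lift x (w f) ∈ wordSpan W (m * (k + 1)) := by
    intro f
    simpa [w] using hword (List.ofFn fun i : Fin k => f i.succ) (f 0)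
  have hli2 : LinearIndependent F
      (fun f => (⟨FreeSemigroup.lift x (w f), hmem f⟩ : wordSpan W (m * (k + 1)))) :=
    LinearIndependent.of_comp (wordSpan W (m * (k + 1))).subtype hli'
  have hcard := hli2.fintype_card_le_finrank
  simp only [Fintype.card_pi, Fintype.card_fin, Finset.prod_const, Finset.card_univ] at hcard
  have h1 : (2 : ℝ) ^ (k + 1) ≤ growth W (m * (k + 1)) := by
    have := (Nat.cast_le (α := ℝ)).2 hcard
    simpa [growth] using this
  refine h1.trans (le_mul_of_one_le_left (Nat.cast_nonneg _) (by exact_mod_cast hm))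

theorem HasFreeSubalgebra.hasExponentialGrowth (h : HasFreeSubalgebra F A)
    (hW : IsGenerating W) : HasExponentialGrowth F A :=
  ⟨⟨W, hW⟩, fun _ hW' => ⟨by have := hW'.1; exact growthLE_two_pow, h.two_pow_growthLE hW'⟩⟩

/-! ### Polynomial bounds and the Gelfand–Kirillov dimension -/

theorem GrowthLE.trans {f g h : ℕ → ℝ} (hfg : GrowthLE f g) (hgh : GrowthLE g h) :
    GrowthLE f h := by
  obtain ⟨c, hc, h1⟩ := hfg
  obtain ⟨d, hd, h2⟩ := hgh
  refine ⟨d * c, Nat.mul_pos hd hc, fun n hn => (h1 n hn).trans ?_⟩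
  have := h2 (c * n) (Nat.mul_pos hc hn)
  calc (c : ℝ) * g (c * n) ≤ c * (d * h (d * (c * n))) :=
        mul_le_mul_of_nonneg_left this (Nat.cast_nonneg _)
    _ = _ := by push_cast; rw [← mul_assoc d c n]; ring

theorem not_two_pow_growthLE_pow (d : ℕ) :
    ¬ GrowthLE (fun n => (2 : ℝ) ^ n) (fun n => (n : ℝ) ^ d) := by
  rintro ⟨c, hc, h⟩
  have hlim := tendsto_pow_const_div_const_pow_of_one_lt d (one_lt_two (α := ℝ))
  have hc0 : (0 : ℝ) < c := by exact_mod_cast hc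
  have hpos : (0 : ℝ) < 1 / (c * (c : ℝ) ^ d) := by positivity
  obtain ⟨n, hn, hn1⟩ :=
    ((hlim.eventually (gt_mem_nhds hpos)).and (Filter.eventually_ge_atTop 1)).exists
  have h1 := h n hn1
  push_cast at h1
  rw [mul_pow, ← mul_assoc] at h1
  rw [div_lt_div_iff₀ (by positivity) (by positivity)] at hn
  linarith

theorem HasExponentialGrowth.not_hasPolynomialGrowth (h : HasExponentialGrowth F A) :
    ¬ HasPolynomialGrowth F A := by
  rintro ⟨⟨W, hW⟩, h'⟩
  obtain ⟨d, hd⟩ := h' W hW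
  exact not_two_pow_growthLE_pow d ((h.2 W hW).2.trans hd)

/-- A polynomial bound with respect to one generating subspace gives one for any other. -/
theorem IsGenerating.exists_growth_le_pow {D : ℕ} {K : ℝ} (hW : IsGenerating W)
    (hK : ∀ n, growth W n ≤ K * (n + 1) ^ D) (hW' : IsGenerating W') :
    ∃ K' : ℝ, 1 ≤ K' ∧ ∀ n, 1 ≤ n → growth W' n ≤ K' * n ^ D := by
  have := hW'.1
  obtain ⟨m, hm, h⟩ := hW.exists_growth_le (W' := W')
  refine ⟨max 1 (|K| * (m + 1) ^ D), le_max_left _ _, fun n hn => ?_⟩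
  have hn' : (1 : ℝ) ≤ n := by exact_mod_cast hn
  calc growth W' n ≤ K * ((m * n : ℕ) + 1) ^ D := (h n).trans (hK _)
    _ ≤ |K| * ((m + 1) * n) ^ D := by
        refine mul_le_mul (le_abs_self K) (pow_le_pow_left₀ (by positivity) ?_ D) (by positivity)
          (abs_nonneg K)
        push_cast
        nlinarith
    _ = |K| * (m + 1) ^ D * n ^ D := by rw [mul_pow]; ring
    _ ≤ _ := mul_le_mul_of_nonneg_right (le_max_right _ _) (by positivity)

theorem IsGenerating.hasPolynomialGrowth {D : ℕ} {K : ℝ} (hW : IsGenerating W)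
    (hK : ∀ n, growth W n ≤ K * (n + 1) ^ D) : HasPolynomialGrowth F A := by
  refine ⟨⟨W, hW⟩, fun W' hW' => ⟨D, ?_⟩⟩
  obtain ⟨K', hK1, h⟩ := hW.exists_growth_le_pow hK hW'
  refine ⟨⌈K'⌉₊, Nat.one_le_ceil_iff.2 (by linarith), fun n hn => (h n hn).trans ?_⟩
  have h1 : (1 : ℝ) ≤ ⌈K'⌉₊ := hK1.trans (Nat.le_ceil K')
  refine mul_le_mul (Nat.le_ceil K') (pow_le_pow_left₀ (by positivity) ?_ D) (by positivity)
    (by positivity)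
  push_cast
  exact le_mul_of_one_le_left (Nat.cast_nonneg _) h1

theorem IsGenerating.exists_pow_le_growth {D C : ℕ} (hW : IsGenerating W) (hC : 1 ≤ C)
    (h : ∀ n : ℕ, ((n : ℝ) + 1) ^ D ≤ growth W (C * (n + 1))) (hW' : IsGenerating W') :
    ∃ (a : ℝ) (Q : ℕ), 0 < a ∧ ∀ n, Q ≤ n → a * n ^ D ≤ growth W' n := by
  have := hW.1
  have := hW'.1
  obtain ⟨m, hm, hle⟩ := hW'.exists_growth_le (W' := W)
  have hQ : 0 < m * C := Nat.mul_pos hm hC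
  -- The given bound lives on multiples of `m * C`. With `k + 1` the integer part of `n / (m * C)`,
  -- one has `n ≤ m * C * (k + 2) ≤ 2 * (m * C) * (k + 1)`, whence the factor `2`.
  refine ⟨(1 / (2 * (m * C : ℕ))) ^ D, m * C, by positivity, fun n hn => ?_⟩
  obtain ⟨k, hk⟩ : ∃ k, n / (m * C) = k + 1 :=
    ⟨n / (m * C) - 1, by have := Nat.div_pos hn hQ; omega⟩
  have h1 : n < (m * C) * (k + 2) := by
    have := Nat.lt_mul_div_succ n hQ
    rwa [hk] at this
  have h2 : m * (C * (k + 1)) ≤ n := by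
    rw [← mul_assoc, ← hk]; exact Nat.mul_div_le n (m * C)
  have h3 : (n : ℝ) ≤ (m * C : ℕ) * (k + 2) := by exact_mod_cast h1.le
  calc (1 / (2 * ((m * C : ℕ) : ℝ))) ^ D * (n : ℝ) ^ D = (n / (2 * (m * C : ℕ))) ^ D := by
        rw [← mul_pow]; ring
    _ ≤ ((k : ℝ) + 1) ^ D := by
        refine pow_le_pow_left₀ (by positivity) ?_ D
        have hQ' : (0 : ℝ) < (m * C : ℕ) := by exact_mod_cast hQ
        rw [div_le_iff₀ (by positivity)]
        have : (0 : ℝ) ≤ k := Nat.cast_nonneg k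
        nlinarith
    _ ≤ growth W' n := (h k).trans ((hle _).trans (growth_mono h2))

/-- Both bounds change the quotient only by a constant over `log n`. For `D = 0` no lower bound is
required: the growth may vanish, and logarithms of natural numbers are nonnegative with `Real.log 0
= 0`. -/
theorem tendsto_log_growth_div_log {D : ℕ} {K a : ℝ} {Q : ℕ} (hK : 1 ≤ K)
    (hup : ∀ n, 1 ≤ n → growth W n ≤ K * n ^ D)
    (ha : 0 < a) (hlow : D = 0 ∨ ∀ n, Q ≤ n → a * n ^ D ≤ growth W n) :
    Filter.Tendsto (fun n : ℕ => Real.log (growth W n) / Real.log n) Filter.atTop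
      (nhds (D : ℝ)) := by
  have hlog : Filter.Tendsto (fun n : ℕ => Real.log n) Filter.atTop Filter.atTop :=
    Real.tendsto_log_atTop.comp tendsto_natCast_atTop_atTop
  have hlim : ∀ c : ℝ, Filter.Tendsto (fun n : ℕ => D + c / Real.log n) Filter.atTop
      (nhds (D : ℝ)) := by
    intro c
    simpa using (hlog.const_div_atTop c).const_add (D : ℝ)
  have hlow' : ∃ c : ℝ, ∀ᶠ n : ℕ in Filter.atTop,
      D + c / Real.log n ≤ Real.log (growth W n) / Real.log n := by
    rcases hlow with rfl | hlow
    · refine ⟨0, Filter.Eventually.of_forall fun n => ?_⟩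
      simp only [Nat.cast_zero, zero_div, add_zero]
      exact div_nonneg (Real.log_natCast_nonneg _) (Real.log_natCast_nonneg _)
    · refine ⟨Real.log a, ?_⟩
      filter_upwards [Filter.eventually_ge_atTop Q, Filter.eventually_ge_atTop 2] with n hn h2
      have hn0 : (0 : ℝ) < n := by exact_mod_cast (by omega : 0 < n)
      have hl : 0 < Real.log n := Real.log_pos (by exact_mod_cast h2)
      rw [le_div_iff₀ hl, add_mul, div_mul_cancel₀ _ hl.ne']
      calc D * Real.log n + Real.log a = Real.log (a * n ^ D) := by
            rw [Real.log_mul ha.ne' (by positivity), Real.log_pow]; ring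
        _ ≤ _ := Real.log_le_log (by positivity) (hlow n hn)
  obtain ⟨c, hc⟩ := hlow'
  refine tendsto_of_tendsto_of_tendsto_of_le_of_le' (hlim c) (hlim (Real.log K)) hc ?_
  filter_upwards [Filter.eventually_ge_atTop 2] with n h2
  have hn0 : (0 : ℝ) < n := by exact_mod_cast (by omega : 0 < n)
  have hl : 0 < Real.log n := Real.log_pos (by exact_mod_cast h2)
  rw [div_le_iff₀ hl, add_mul, div_mul_cancel₀ _ hl.ne']
  have hlogK : (D : ℝ) * Real.log n + Real.log K = Real.log (K * n ^ D) := by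
    rw [Real.log_mul (by linarith) (by positivity), Real.log_pow]; ring
  rcases (Nat.cast_nonneg _ : 0 ≤ growth W n).eq_or_lt with h0 | h0
  · rw [show growth W n = 0 from h0.symm, Real.log_zero]
    have := Real.log_nonneg hK
    positivity
  · rw [hlogK]
    exact Real.log_le_log h0 (hup n (by omega))

theorem IsGenerating.hasGKDim {D : ℕ} {K : ℝ} (hW : IsGenerating W)
    (hK : ∀ n, growth W n ≤ K * (n + 1) ^ D)
    (hlow : D = 0 ∨ ∃ C : ℕ, 1 ≤ C ∧ ∀ n : ℕ, ((n : ℝ) + 1) ^ D ≤ growth W (C * (n + 1))) :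
    HasGKDim F A ((D : ℝ) : EReal) := by
  refine ⟨⟨W, hW⟩, fun W' hW' => Filter.Tendsto.limsup_eq ?_⟩
  obtain ⟨K', hK1, hup⟩ := hW.exists_growth_le_pow hK hW'
  have key : Filter.Tendsto (fun n : ℕ => Real.log (growth W' n) / Real.log n) Filter.atTop
      (nhds (D : ℝ)) := by
    rcases hlow with hD | ⟨C, hC, h⟩
    · exact tendsto_log_growth_div_log (Q := 0) hK1 hup one_pos (Or.inl hD)
    · obtain ⟨a, Q, ha, h⟩ := hW.exists_pow_le_growth hC h hW'
      exact tendsto_log_growth_div_log hK1 hup ha (Or.inr h)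
  exact (continuous_coe_real_ereal.tendsto _).comp key

end GrowthLemmas

/-! ### The Leavitt path algebra: generators and monomials -/

namespace DirGraph

namespace Leavitt

variable {V E : Type*} (F : Type*) [Field F] (Γ : DirGraph V E)

/-- The image of a generator in the Leavitt path algebra. -/
noncomputable def gen (g : Gen V E) : Γ.Leavitt F :=
  mk F Γ (MonoidAlgebra.single (FreeSemigroup.of g) 1)

/-- The vertex `v` as an element of the Leavitt path algebra. -/
noncomputable def vert (v : V) : Γ.Leavitt F := gen F Γ (.vert v)

/-- The edge `e` as an element of the Leavitt path algebra. -/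
noncomputable def edge (e : E) : Γ.Leavitt F := gen F Γ (.edge e)

/-- The element `e*` of the Leavitt path algebra. -/
noncomputable def ghost (e : E) : Γ.Leavitt F := gen F Γ (.ghost e)

variable {F Γ}

theorem mk_relator {x : FreeAlg F V E} (hx : IsRelator F Γ x) : mk F Γ x = 0 := by
  have : x ∈ relIdeal F Γ := by
    rw [relIdeal, Submodule.mem_sInf]
    exact fun I hI => hI.1 x hx
  exact (Submodule.Quotient.mk_eq_zero _).2 this

theorem vert_mul_self (v : V) : vert F Γ v * vert F Γ v = vert F Γ v := by
  have := mk_relator (IsRelator.vert_self (F := F) (Γ := Γ) v)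
  rwa [map_sub, sub_eq_zero] at this

theorem vert_mul_of_ne {v w : V} (h : v ≠ w) : vert F Γ v * vert F Γ w = 0 :=
  mk_relator (IsRelator.vert_ne (F := F) (Γ := Γ) v w h)

theorem source_mul_edge (e : E) : vert F Γ (Γ.s e) * edge F Γ e = edge F Γ e := by
  have := mk_relator (IsRelator.source_edge (F := F) (Γ := Γ) e)
  rwa [map_sub, sub_eq_zero] at this

theorem edge_mul_range (e : E) : edge F Γ e * vert F Γ (Γ.r e) = edge F Γ e := by
  have := mk_relator (IsRelator.edge_range (F := F) (Γ := Γ) e)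
  rwa [map_sub, sub_eq_zero] at this

theorem range_mul_ghost (e : E) : vert F Γ (Γ.r e) * ghost F Γ e = ghost F Γ e := by
  have := mk_relator (IsRelator.range_ghost (F := F) (Γ := Γ) e)
  rwa [map_sub, sub_eq_zero] at this

theorem ghost_mul_source (e : E) : ghost F Γ e * vert F Γ (Γ.s e) = ghost F Γ e := by
  have := mk_relator (IsRelator.ghost_source (F := F) (Γ := Γ) e)
  rwa [map_sub, sub_eq_zero] at this

theorem ghost_mul_edge_self (e : E) : ghost F Γ e * edge F Γ e = vert F Γ (Γ.r e) := by
  have := mk_relator (IsRelator.ghost_edge_self (F := F) (Γ := Γ) e)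
  rwa [map_sub, sub_eq_zero] at this

theorem ghost_mul_edge_of_ne {e f : E} (h : e ≠ f) : ghost F Γ e * edge F Γ f = 0 :=
  mk_relator (IsRelator.ghost_edge_ne (F := F) (Γ := Γ) e f h)

/-- If `e` is the only edge with its source, then `e e* = s(e)`. -/
theorem edge_mul_ghost {e : E} (h : ∀ f, Γ.s f = Γ.s e → f = e) :
    edge F Γ e * ghost F Γ e = vert F Γ (Γ.s e) := by
  have := mk_relator (IsRelator.sum_edges (F := F) (Γ := Γ) (Γ.s e) {e} (by simp)
    fun f => ⟨fun hf => by rw [Finset.mem_singleton.1 hf], fun hf => by simp [h f hf]⟩)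
  rw [map_sub, sub_eq_zero, Finset.sum_singleton] at this
  exact this.symm

variable (F Γ)

/-- The element `e₁ ⋯ eₙ v` of the Leavitt path algebra. -/
noncomputable def path (p : List E) (v : V) : Γ.Leavitt F :=
  p.foldr (fun e x => edge F Γ e * x) (vert F Γ v)

/-- The element `v eₙ* ⋯ e₁*` of the Leavitt path algebra. -/
noncomputable def ghostPath (p : List E) (v : V) : Γ.Leavitt F :=
  p.foldr (fun e x => x * ghost F Γ e) (vert F Γ v)

variable {F Γ}

@[simp] theorem path_nil (v : V) : path F Γ [] v = vert F Γ v := rfl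

@[simp] theorem path_cons (e : E) (p : List E) (v : V) :
    path F Γ (e :: p) v = edge F Γ e * path F Γ p v := rfl

@[simp] theorem ghostPath_nil (v : V) : ghostPath F Γ [] v = vert F Γ v := rfl

@[simp] theorem ghostPath_cons (e : E) (p : List E) (v : V) :
    ghostPath F Γ (e :: p) v = ghostPath F Γ p v * ghost F Γ e := rfl

theorem path_mul_vert (p : List E) (v : V) : path F Γ p v * vert F Γ v = path F Γ p v := by
  induction p with
  | nil => exact vert_mul_self v
  | cons e p ih => rw [path_cons, mul_assoc, ih]

theorem vert_mul_ghostPath (p : List E) (v : V) :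
    vert F Γ v * ghostPath F Γ p v = ghostPath F Γ p v := by
  induction p with
  | nil => exact vert_mul_self v
  | cons e p ih => rw [ghostPath_cons, ← mul_assoc, ih]

theorem vert_mul_path {u v : V} {p : List E} (h : Γ.Walk u p v) :
    vert F Γ u * path F Γ p v = path F Γ p v := by
  cases p with
  | nil =>
    obtain rfl := walk_nil.1 h
    exact vert_mul_self u
  | cons e p => rw [path_cons, ← mul_assoc, ← h.1, source_mul_edge]

theorem ghostPath_mul_vert {u v : V} {p : List E} (h : Γ.Walk u p v) :
    ghostPath F Γ p v * vert F Γ u = ghostPath F Γ p v := by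
  cases p with
  | nil =>
    obtain rfl := walk_nil.1 h
    exact vert_mul_self u
  | cons e p => rw [ghostPath_cons, mul_assoc, ← h.1, ghost_mul_source]

theorem vert_mul_path_of_ne {u u' v : V} {p : List E} (h : Γ.Walk u p v) (hu : u' ≠ u) :
    vert F Γ u' * path F Γ p v = 0 := by
  rw [← vert_mul_path h, ← mul_assoc, vert_mul_of_ne hu, zero_mul]

theorem path_append {u v w : V} {p q : List E} (hp : Γ.Walk u p v) (hq : Γ.Walk v q w) :
    path F Γ (p ++ q) w = path F Γ p v * path F Γ q w := by
  induction p generalizing u with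
  | nil => rw [List.nil_append, path_nil, vert_mul_path hq]
  | cons e p ih => rw [List.cons_append, path_cons, path_cons, mul_assoc, ih hp.2]

theorem ghostPath_append {u v w : V} {p q : List E} (hp : Γ.Walk u p v) (hq : Γ.Walk v q w) :
    ghostPath F Γ (p ++ q) w = ghostPath F Γ q w * ghostPath F Γ p v := by
  induction p generalizing u with
  | nil => rw [List.nil_append, ghostPath_nil, ghostPath_mul_vert hq]
  | cons e p ih => rw [List.cons_append, ghostPath_cons, ghostPath_cons, ← mul_assoc, ih hp.2]

theorem ghostPath_mul_path_self {u v : V} {p : List E} (h : Γ.Walk u p v) :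
    ghostPath F Γ p v * path F Γ p v = vert F Γ v := by
  induction p generalizing u with
  | nil => exact vert_mul_self v
  | cons e p ih =>
    rw [ghostPath_cons, path_cons, mul_assoc, ← mul_assoc (ghost F Γ e), ghost_mul_edge_self,
      vert_mul_path h.2, ih h.2]

theorem ghostPath_mul_path_append {u v w : V} {p q : List E} (hp : Γ.Walk u p v)
    (hq : Γ.Walk v q w) : ghostPath F Γ p v * path F Γ (p ++ q) w = path F Γ q w := by
  rw [path_append hp hq, ← mul_assoc, ghostPath_mul_path_self hp, vert_mul_path hq]

/-- The product `p* q` vanishes if `p` and `q` diverge. -/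
theorem ghostPath_mul_path_of_ne {u v w : V} {a b c : List E} {e f : E} (hef : e ≠ f)
    (hp : Γ.Walk u (a ++ e :: b) v) (hq : Γ.Walk u (a ++ f :: c) w) :
    ghostPath F Γ (a ++ e :: b) v * path F Γ (a ++ f :: c) w = 0 := by
  obtain ⟨x, h1, h2⟩ := walk_append.1 hp
  obtain ⟨y, h3, h4⟩ := walk_append.1 hq
  obtain rfl := h1.end_unique h3
  rw [ghostPath_append h1 h2, mul_assoc, ghostPath_mul_path_append h1 h4, ghostPath_cons,
    path_cons, mul_assoc, ← mul_assoc (ghost F Γ e), ghost_mul_edge_of_ne hef, zero_mul,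
    mul_zero]

variable (F Γ)

/-- The span of the generators. -/
noncomputable def genSpan : Submodule F (Γ.Leavitt F) := Submodule.span F (Set.range (gen F Γ))

instance [Finite V] [Finite E] : Finite (Gen V E) :=
  Finite.of_surjective (Sum.elim Gen.vert (Sum.elim Gen.edge Gen.ghost) : V ⊕ E ⊕ E → Gen V E) <| by
    rintro (v | e | e)
    · exact ⟨.inl v, rfl⟩
    · exact ⟨.inr (.inl e), rfl⟩
    · exact ⟨.inr (.inr e), rfl⟩

variable {F Γ}

theorem gen_mem_genSpan (g : Gen V E) : gen F Γ g ∈ genSpan F Γ :=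
  Submodule.subset_span ⟨g, rfl⟩

theorem genSpan_isGenerating [Finite V] [Finite E] : IsGenerating (genSpan F Γ) := by
  refine ⟨FiniteDimensional.span_of_finite F (Set.finite_range _), ?_⟩
  rw [eq_top_iff]
  intro a ha
  clear ha
  obtain ⟨x, rfl⟩ := mk_surjective F Γ a
  induction x using MonoidAlgebra.induction_linear with
  | zero => rw [map_zero]; exact zero_mem _
  | add f g hf hg => rw [map_add]; exact add_mem hf hg
  | single w c =>
    have hw : mk F Γ (MonoidAlgebra.single w 1) ∈
        NonUnitalAlgebra.adjoin F (genSpan F Γ : Set (Γ.Leavitt F)) := by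
      induction w using FreeSemigroup.recOnMul with
      | ih1 g => exact NonUnitalAlgebra.subset_adjoin F (gen_mem_genSpan g)
      | ih2 g w h1 h2 =>
        rw [← one_mul (1 : F), ← MonoidAlgebra.single_mul_single, mk_mul]
        exact mul_mem h1 h2
    have : MonoidAlgebra.single w c = c • (MonoidAlgebra.single w 1 : FreeAlg F V E) := by simp
    rw [this, map_smul]
    exact SMulMemClass.smul_mem c hw

theorem path_mem {p : List E} {v : V} {n : ℕ} (hn : p.length + 1 ≤ n) :
    path F Γ p v ∈ wordSpan (genSpan F Γ) n := by
  induction p generalizing n with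
  | nil => exact le_wordSpan hn (gen_mem_genSpan _)
  | cons e p ih =>
    obtain ⟨n, rfl⟩ : ∃ m, n = 1 + m := ⟨n - 1, by omega⟩
    simp only [List.length_cons] at hn
    exact mul_mem_wordSpan (le_wordSpan le_rfl (gen_mem_genSpan _)) (ih (by omega))

theorem ghostPath_mem {p : List E} {v : V} {n : ℕ} (hn : p.length + 1 ≤ n) :
    ghostPath F Γ p v ∈ wordSpan (genSpan F Γ) n := by
  induction p generalizing n with
  | nil => exact le_wordSpan hn (gen_mem_genSpan _)
  | cons e p ih =>
    obtain ⟨n, rfl⟩ : ∃ m, n = m + 1 := ⟨n - 1, by omega⟩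
    simp only [List.length_cons] at hn
    exact mul_mem_wordSpan (ih (by omega)) (le_wordSpan le_rfl (gen_mem_genSpan _))

end Leavitt

/-! ### A graded representation on functions -/

/-- Pullback of functions along a partial map. -/
def pullback (F : Type*) [Field F] {X : Type*} (f : X → Option X) : Module.End F (X → F) where
  toFun φ x := (f x).elim 0 φ
  map_add' φ ψ := by
    funext x
    cases h : f x <;> simp [h]
  map_smul' c φ := by
    funext x
    cases h : f x <;> simp [h]

theorem pullback_apply {F : Type*} [Field F] {X : Type*} (f : X → Option X) (φ : X → F) (x : X) :
    pullback F f φ x = (f x).elim 0 φ := rfl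

/-- A branching system for `Γ`: the fibre of `V × ℕ` over a vertex that is not a sink is the
disjoint union of copies of `ℕ` indexed by the edges with that source. -/
theorem exists_branching {V E : Type*} [Finite E] (Γ : DirGraph V E) :
    ∃ (σ : E → ℕ → ℕ) (τ : V → ℕ → Option (E × ℕ)),
      (∀ e n, τ (Γ.s e) (σ e n) = some (e, n)) ∧
      (∀ v n e m, τ v n = some (e, m) → Γ.s e = v ∧ σ e m = n) ∧
      ∀ v n, τ v n = none → ∀ e, Γ.s e ≠ v := by
  classical
  -- A nonempty finite set times `ℕ` is countably infinite; `σ` and `τ` are this bijection and its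
  -- inverse.
  let Φ : ∀ v, Nonempty {e // Γ.s e = v} → ({e // Γ.s e = v} × ℕ ≃ ℕ) := fun v _ =>
    (nonempty_equiv_of_countable (α := {e // Γ.s e = v} × ℕ) (β := ℕ)).some
  let σ : E → ℕ → ℕ := fun e n => Φ (Γ.s e) ⟨⟨e, rfl⟩⟩ (⟨e, rfl⟩, n)
  have hσ : ∀ v hv (x : {e // Γ.s e = v} × ℕ), σ x.1 x.2 = Φ v hv x := by
    rintro v hv ⟨⟨e, rfl⟩, n⟩
    rfl
  refine ⟨σ, fun v n => if h : Nonempty {e // Γ.s e = v} then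
      some ((((Φ v h).symm n).1 : E), ((Φ v h).symm n).2) else none, ?_, ?_, ?_⟩
  · intro e n
    have : Nonempty {f // Γ.s f = Γ.s e} := ⟨⟨e, rfl⟩⟩
    simp [this, σ]
  · intro v n e m h
    dsimp only at h
    by_cases hv : Nonempty {e // Γ.s e = v}
    · rw [dif_pos hv] at h
      simp only [Option.some.injEq, Prod.mk.injEq] at h
      obtain ⟨rfl, rfl⟩ := h
      exact ⟨((Φ v hv).symm n).1.2, by rw [hσ v hv, Equiv.apply_symm_apply]⟩
    · rw [dif_neg hv] at h
      exact absurd h (by simp)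
  · intro v n h e he
    have hv : Nonempty {e // Γ.s e = v} := ⟨⟨e, he⟩⟩
    simp [hv] at h

theorem pullback_mul {F : Type*} [Field F] {X : Type*} (f g : X → Option X) :
    pullback F f * pullback F g = pullback F fun x => (f x).bind g := by
  ext φ x
  simp only [Module.End.mul_apply, pullback_apply]
  cases f x <;> simp [pullback_apply]

theorem pullback_none {F : Type*} [Field F] {X : Type*} :
    pullback F (fun _ : X => none) = 0 := by
  ext φ x
  simp [pullback_apply]

section Representation

variable {V E : Type*} (Γ : DirGraph V E)

open Classical in
/-- The partial maps on `V × ℕ × ℤ` by which the generators act. -/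
noncomputable def genMap (σ : E → ℕ → ℕ) (τ : V → ℕ → Option (E × ℕ)) :
    Gen V E → V × ℕ × ℤ → Option (V × ℕ × ℤ)
  | .vert v, x => if x.1 = v then some x else none
  | .edge e, x => (τ x.1 x.2.1).bind fun y =>
      if y.1 = e then some (Γ.r e, y.2, x.2.2 - 1) else none
  | .ghost e, x => if x.1 = Γ.r e then some (Γ.s e, σ e x.2.1, x.2.2 + 1) else none

variable {Γ} {σ : E → ℕ → ℕ} {τ : V → ℕ → Option (E × ℕ)}

/-- Products of pullbacks are pullbacks along composed partial maps, so all relators but the last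
reduce to identities of partial maps. In the last one, `τ` selects for each point over `v` exactly
one edge `e`, and only the summand `e e*` acts there, as the identity; `h3` ensures that every such
point is covered. -/
theorem relator_lift_eq_zero (F : Type*) [Field F] (h1 : ∀ e n, τ (Γ.s e) (σ e n) = some (e, n))
    (h2 : ∀ v n e m, τ v n = some (e, m) → Γ.s e = v ∧ σ e m = n)
    (h3 : ∀ v n, τ v n = none → ∀ e, Γ.s e ≠ v) {x : FreeAlg F V E} (hx : IsRelator F Γ x) :
    MonoidAlgebra.liftMagma F (FreeSemigroup.lift fun g => pullback F (genMap Γ σ τ g)) x = 0 := by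
  classical
  have hgen : ∀ g, MonoidAlgebra.liftMagma F
      (FreeSemigroup.lift fun g => pullback F (genMap Γ σ τ g))
      (MonoidAlgebra.single (FreeSemigroup.of g) 1 : FreeAlg F V E) =
        pullback F (genMap Γ σ τ g) := by
    intro g
    simp [MonoidAlgebra.liftMagma]
  cases hx with
  | vert_self v =>
    simp only [fv, map_sub, map_mul, hgen, pullback_mul, sub_eq_zero]
    congr 1
    funext x
    by_cases hxv : x.1 = v <;> simp [genMap, hxv]
  | vert_ne v w hvw =>
    simp only [fv, map_mul, hgen, pullback_mul]
    rw [← pullback_none]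
    congr 1
    funext x
    by_cases hxv : x.1 = v <;> simp [genMap, hxv, hvw]
  | source_edge e =>
    simp only [fv, fe, map_sub, map_mul, hgen, pullback_mul, sub_eq_zero]
    congr 1
    funext x
    by_cases hxv : x.1 = Γ.s e
    · simp [genMap, hxv]
    · cases hτ : τ x.1 x.2.1 with
      | none => simp [genMap, hxv, hτ]
      | some y =>
        have : y.1 ≠ e := fun h => hxv (h ▸ (h2 _ _ _ _ hτ).1).symm
        simp [genMap, hxv, hτ, this]
  | edge_range e =>
    simp only [fv, fe, map_sub, map_mul, hgen, pullback_mul, sub_eq_zero]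
    congr 1
    funext x
    cases hτ : τ x.1 x.2.1 with
    | none => simp [genMap, hτ]
    | some y => by_cases hy : y.1 = e <;> simp [genMap, hτ, hy]
  | range_ghost e =>
    simp only [fv, fs, map_sub, map_mul, hgen, pullback_mul, sub_eq_zero]
    congr 1
    funext x
    by_cases hxv : x.1 = Γ.r e <;> simp [genMap, hxv]
  | ghost_source e =>
    simp only [fv, fs, map_sub, map_mul, hgen, pullback_mul, sub_eq_zero]
    congr 1
    funext x
    by_cases hxv : x.1 = Γ.r e <;> simp [genMap, hxv]
  | ghost_edge_self e =>
    simp only [fv, fe, fs, map_sub, map_mul, hgen, pullback_mul, sub_eq_zero]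
    congr 1
    funext x
    by_cases hxv : x.1 = Γ.r e
    · obtain ⟨v, n, z⟩ := x
      obtain rfl : v = Γ.r e := hxv
      simp [genMap, h1]
    · simp [genMap, hxv]
  | ghost_edge_ne e f hef =>
    simp only [fe, fs, map_mul, hgen, pullback_mul]
    rw [← pullback_none]
    congr 1
    funext x
    by_cases hxv : x.1 = Γ.r e <;> simp [genMap, hxv, h1, hef]
  | sum_edges v S hS hSv =>
    simp only [fv, fe, fs, map_sub, map_sum, map_mul, hgen, pullback_mul, sub_eq_zero]
    ext φ x
    simp only [LinearMap.sum_apply, Finset.sum_apply, pullback_apply]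
    cases hτ : τ x.1 x.2.1 with
    | none =>
      obtain ⟨e, he⟩ := hS
      have : x.1 ≠ v := fun h => h3 _ _ hτ e (by rw [h, (hSv e).1 he])
      simp [genMap, hτ, this]
    | some y =>
      obtain ⟨hs, hσ⟩ := h2 _ _ _ _ hτ
      have hterm : ∀ e, (((genMap Γ σ τ (.edge e) x).bind (genMap Γ σ τ (.ghost e))).elim 0 φ : F)
          = if e = y.1 then φ x else 0 := by
        intro e
        by_cases hy : y.1 = e
        · subst hy
          simp [genMap, hτ, hs, hσ]
        · simp [genMap, hτ, hy, Ne.symm hy]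
      simp only [hterm, Finset.sum_ite_eq', hSv, hs]
      by_cases hxv : x.1 = v <;> simp [genMap, hxv]

/-- Vertices are independent of paths of positive length. -/
theorem exists_functional [Finite E] (F : Type*) [Field F] (Γ : DirGraph V E) (v : V) :
    ∃ ε : Γ.Leavitt F →ₗ[F] F, ε (Leavitt.vert F Γ v) = 1 ∧
      ∀ p w, p ≠ [] → ε (Leavitt.path F Γ p w) = 0 := by
  classical
  obtain ⟨σ, τ, h1, h2, h3⟩ := exists_branching Γ
  let Λ : FreeAlg F V E →ₙₐ[F] Module.End F (V × ℕ × ℤ → F) :=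
    MonoidAlgebra.liftMagma F (FreeSemigroup.lift fun g => pullback F (genMap Γ σ τ g))
  let Λ' : FreeAlg F V E →ₗ[F] Module.End F (V × ℕ × ℤ → F) :=
    { toFun := Λ, map_add' := map_add Λ, map_smul' := map_smul Λ }
  have hker : relIdeal F Γ ≤ LinearMap.ker Λ' := by
    refine sInf_le ⟨fun x hx => relator_lift_eq_zero F h1 h2 h3 hx, fun a x hx => ?_⟩
    have hx' : Λ x = 0 := hx
    constructor
    · show Λ (a * x) = 0
      rw [map_mul, hx', mul_zero]
    · show Λ (x * a) = 0
      rw [map_mul, hx', zero_mul]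
  let ρ : Γ.Leavitt F →ₗ[F] Module.End F (V × ℕ × ℤ → F) :=
    (relIdeal F Γ).liftQ Λ' hker
  have hρ : ∀ x, ρ (Leavitt.mk F Γ x) = Λ x := fun x => rfl
  have hmul : ∀ a b, ρ (a * b) = ρ a * ρ b := by
    intro a b
    obtain ⟨x, rfl⟩ := Leavitt.mk_surjective F Γ a
    obtain ⟨y, rfl⟩ := Leavitt.mk_surjective F Γ b
    rw [← Leavitt.mk_mul, hρ, hρ, hρ, map_mul]
  have hgen : ∀ g, ρ (Leavitt.gen F Γ g) = pullback F (genMap Γ σ τ g) := by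
    intro g
    rw [Leavitt.gen, hρ]
    simp [Λ, MonoidAlgebra.liftMagma]
  -- The integer coordinate records degree. On the indicator of degree `0`, a path of length `k`
  -- produces a function supported in degree `k`; evaluation in degree `0` therefore detects `v` and
  -- kills paths of positive length.
  let φ₀ : V × ℕ × ℤ → F := fun x => if x.2.2 = 0 then 1 else 0
  refine ⟨LinearMap.proj (v, 0, 0) ∘ₗ LinearMap.applyₗ φ₀ ∘ₗ ρ, ?_, fun p w hp => ?_⟩
  · simp [Leavitt.vert, hgen, pullback_apply, genMap, φ₀]
  · have hsupp : ∀ (p : List E) (x : V × ℕ × ℤ), x.2.2 ≠ p.length →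
        ρ (Leavitt.path F Γ p w) φ₀ x = 0 := by
      intro p
      induction p with
      | nil =>
        intro x hx
        simp only [List.length_nil, Nat.cast_zero] at hx
        by_cases hxv : x.1 = w <;>
          simp [Leavitt.vert, hgen, pullback_apply, genMap, φ₀, hx, hxv]
      | cons e p ih =>
        intro x hx
        rw [Leavitt.path_cons, hmul, Leavitt.edge, hgen, Module.End.mul_apply, pullback_apply]
        cases hτ : τ x.1 x.2.1 with
        | none => simp [genMap, hτ]
        | some y =>
          by_cases hy : y.1 = e
          · simp only [genMap, hτ, Option.bind_some, hy, if_true, Option.elim_some]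
            apply ih
            simp only [List.length_cons, Nat.cast_add, Nat.cast_one] at hx
            intro h
            exact hx (by simp only at h; omega)
          · simp [genMap, hτ, hy]
    refine hsupp p _ ?_
    have := List.length_pos_iff.2 hp
    simp only [ne_eq]
    omega

end Representation

end DirGraph

/-! ### Diverging families of walks -/

namespace DirGraph

variable {V E : Type*} {Γ : DirGraph V E}

/-- After a common initial segment, `p` and `q` continue with different edges. -/
def Diverge (p q : List E) : Prop :=
  ∃ (a : List E) (e f : E) (b c : List E), e ≠ f ∧ p = a ++ e :: b ∧ q = a ++ f :: c

theorem Diverge.symm {p q : List E} (h : Diverge p q) : Diverge q p := by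
  obtain ⟨a, e, f, b, c, hef, hp, hq⟩ := h
  exact ⟨a, f, e, c, b, hef.symm, hq, hp⟩

theorem Diverge.append_left {p q : List E} (h : Diverge p q) (l : List E) :
    Diverge (l ++ p) (l ++ q) := by
  obtain ⟨a, e, f, b, c, hef, rfl, rfl⟩ := h
  exact ⟨l ++ a, e, f, b, c, hef, by simp, by simp⟩

theorem Diverge.append_ne {p q : List E} (h : Diverge p q) (x y : List E) : p ++ x ≠ q ++ y := by
  obtain ⟨a, e, f, b, c, hef, rfl, rfl⟩ := h
  simp [hef]

theorem Diverge.ne_nil {p q : List E} (h : Diverge p q) : p ≠ [] := by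
  obtain ⟨a, e, f, b, c, hef, rfl, rfl⟩ := h
  simp

/-- The `P i` form a prefix code: the first block of a concatenation is determined, and the rest
follows by cancellation. -/
theorem flatMap_injective {ι : Type*} {P : ι → List E} (hne : ∀ i, P i ≠ [])
    (hP : ∀ i j, i ≠ j → Diverge (P i) (P j)) : Function.Injective (List.flatMap P) := by
  intro s
  induction s with
  | nil =>
    intro t h
    cases t with
    | nil => rfl
    | cons j t => simp [hne] at h
  | cons i s ih =>
    intro t h
    cases t with
    | nil => simp [hne] at h
    | cons j t =>
      simp only [List.flatMap_cons] at h
      by_cases hij : i = j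
      · subst hij
        rw [ih (List.append_cancel_left h)]
      · exact absurd h ((hP i j hij).append_ne _ _)

theorem walk_flatMap {ι : Type*} {P : ι → List E} {v : V} (hP : ∀ i, Γ.Walk v (P i) v)
    (t : List ι) : Γ.Walk v (t.flatMap P) v := by
  induction t with
  | nil => rfl
  | cons i t ih => exact (hP i).append ih

/-- The `n`-fold repetition of a list. -/
def iter (c : List E) (n : ℕ) : List E := (List.replicate n ()).flatMap fun _ => c

theorem iter_add (c : List E) (m n : ℕ) : iter c (m + n) = iter c m ++ iter c n := by
  rw [iter, iter, iter, List.replicate_add, List.flatMap_append]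

theorem iter_succ (c : List E) (n : ℕ) : iter c (n + 1) = c ++ iter c n := rfl

theorem length_iter (c : List E) (n : ℕ) : (iter c n).length = n * c.length := by
  induction n with
  | zero => simp [iter]
  | succ n ih => rw [iter_succ, List.length_append, ih]; ring

theorem iter_injective {c : List E} (hc : c ≠ []) : Function.Injective (iter c) := by
  intro m n h
  have := congrArg List.length h
  rw [length_iter, length_iter] at this
  exact Nat.eq_of_mul_eq_mul_right (List.length_pos_iff.2 hc) this

theorem Walk.iter {v : V} {c : List E} (h : Γ.Walk v c v) (n : ℕ) : Γ.Walk v (iter c n) v :=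
  walk_flatMap (fun _ => h) _

/-- A pairwise diverging family of walks from `u` to `w` with `k` parameters, whose lengths are
bounded linearly in the parameters. -/
def Fan (Γ : DirGraph V E) (u w : V) (k : ℕ) : Prop :=
  ∃ (π : (Fin k → ℕ) → List E) (c : ℕ), (∀ x, Γ.Walk u (π x) w) ∧
    (∀ x y, x ≠ y → Diverge (π x) (π y)) ∧
    ∀ x n, (∀ i, x i ≤ n) → (π x).length ≤ c * (n + 1)

theorem fan_zero (v : V) : Γ.Fan v v 0 :=
  ⟨fun _ => [], 0, fun _ => rfl, fun x y h => absurd (Subsingleton.elim x y) h, by simp⟩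

theorem Fan.prepend {u v w : V} {k : ℕ} (h : Γ.Fan v w k) {p : List E} (hp : Γ.Walk u p v) :
    Γ.Fan u w k := by
  obtain ⟨π, c, h1, h2, h3⟩ := h
  refine ⟨fun x => p ++ π x, p.length + c, fun x => hp.append (h1 x),
    fun x y hxy => (h2 x y hxy).append_left p, fun x n hx => ?_⟩
  have := h3 x n hx
  rw [List.length_append]
  nlinarith

/-- Going around a cycle before leaving it adds a parameter. -/
theorem Fan.cycle {w : V} {k : ℕ} {C : Γ.Cycle} {e : E} (hs : Γ.s e ∈ C.verts)
    (he : e ∉ C.edges) (h : Γ.Fan (Γ.r e) w k) : Γ.Fan (Γ.s e) w (k + 1) := by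
  obtain ⟨π, c, h1, h2, h3⟩ := h
  obtain ⟨z, hz, hzw, -, -, hE⟩ := C.exists_walk hs
  -- After `x 0` turns, one walk leaves along `e` while the other begins another turn with an edge
  -- of `C`, and `e` is not such an edge.
  have key : ∀ (x y : Fin (k + 1) → ℕ), x 0 < y 0 →
      Diverge (iter z (x 0) ++ e :: π (Fin.tail x)) (iter z (y 0) ++ e :: π (Fin.tail y)) := by
    intro x y hxy
    obtain ⟨m, hm⟩ := Nat.exists_eq_add_of_lt hxy
    obtain ⟨f, z', rfl⟩ := List.exists_cons_of_ne_nil hz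
    refine ⟨iter (f :: z') (x 0), e, f, π (Fin.tail x),
      z' ++ iter (f :: z') m ++ e :: π (Fin.tail y), ?_, rfl, ?_⟩
    · rintro rfl
      exact he (by rw [hE]; simp)
    · rw [hm, add_assoc, iter_add, iter_succ]
      simp
  refine ⟨fun x => iter z (x 0) ++ e :: π (Fin.tail x), z.length + 1 + c,
    fun x => (hzw.iter _).append ⟨rfl, h1 _⟩, fun x y hxy => ?_, fun x n hx => ?_⟩
  · rcases lt_trichotomy (x 0) (y 0) with h | h | h
    · exact key x y h
    · have ht : Fin.tail x ≠ Fin.tail y := by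
        intro ht
        apply hxy
        rw [← Fin.cons_self_tail x, ← Fin.cons_self_tail y, h, ht]
      simp only [h]
      exact ((h2 _ _ ht).append_left [e]).append_left (iter z (y 0))
    · exact (key y x h).symm
  · have h4 := h3 (Fin.tail x) n fun i => hx i.succ
    have h5 : x 0 * z.length ≤ n * z.length := Nat.mul_le_mul_right _ (hx 0)
    simp only [List.length_append, length_iter, List.length_cons]
    nlinarith

theorem Walk.exists_leaving_edge {u v : V} {p : List E} {C : Γ.Cycle} (h : Γ.Walk u p v)
    (hu : u ∈ C.verts) (hv : v ∉ C.verts) :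
    ∃ e, Γ.s e ∈ C.verts ∧ e ∉ C.edges ∧ Γ.Reach (Γ.r e) v := by
  induction p generalizing u with
  | nil => exact absurd (walk_nil.1 h ▸ hu) hv
  | cons e p ih =>
    by_cases he : e ∈ C.edges
    · exact ih h.2 (C.range_mem he)
    · exact ⟨e, h.1 ▸ hu, he, p, h.2⟩

theorem Fan.of_reach {u v w : V} {k : ℕ} (h : Γ.Fan v w k) (hr : Γ.Reach u v) : Γ.Fan u w k := by
  obtain ⟨p, hp⟩ := hr
  exact h.prepend hp

theorem CyclesDisjoint.exists_fan (hΓ : Γ.CyclesDisjoint) {l : List Γ.Cycle} {B : Γ.Cycle}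
    (hl : Γ.IsCycleChain (l ++ [B])) {v w : V} {m : ℕ} (hv : v ∈ B.verts) (h : Γ.Fan v w m) :
    ∃ u, Γ.Fan u w (l.length + m) := by
  -- The induction must remember that the fan starts on the first cycle, so that the preceding cycle
  -- can be linked to it by a walk, which has to leave that cycle because the cycles are disjoint.
  suffices H : ∃ A, (l ++ [B]).head? = some A ∧ ∃ u ∈ A.verts, Γ.Fan u w (l.length + m) by
    obtain ⟨A, -, u, -, hu⟩ := H
    exact ⟨u, hu⟩
  induction l with
  | nil => exact ⟨B, rfl, v, hv, by simpa using h⟩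
  | cons C l ih =>
    obtain ⟨hnd, hch⟩ := hl
    rw [List.cons_append] at hnd hch
    obtain ⟨A, hA, u, hu, hf⟩ := ih ⟨(List.nodup_cons.1 hnd).2, hch.tail⟩
    have hCA : C.Reaches A := (List.isChain_cons.1 hch).1 A hA
    have hne : C ≠ A := by
      rintro rfl
      exact (List.nodup_cons.1 hnd).1 (List.mem_of_mem_head? hA)
    obtain ⟨x, hx, y, hy, hxy⟩ := hCA.exists_reach
    obtain ⟨p, hp⟩ := hxy.trans (A.reach hy hu)
    obtain ⟨e, hs, he, hr⟩ := hp.exists_leaving_edge hx fun huC => hne (hΓ.eq huC hu)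
    refine ⟨C, rfl, Γ.s e, hs, ?_⟩
    have := Fan.cycle hs he (hf.of_reach hr)
    rw [List.length_cons, Nat.add_right_comm]
    exact this

/-! ### Linear independence of monomials -/

namespace Leavitt

variable {F : Type*} [Field F]

/-- In a relation, multiply on the left by `p*` for a shortest `p` with nonzero coefficient. Every
other term becomes a path of positive length or zero, so the functional `ε` isolates the coefficient
of `p`. -/
theorem linearIndependent_path [Finite E] {ι : Type*} {P : ι → List E} {v : V}
    (hP : ∀ i, Γ.Walk v (P i) v) (hinj : Function.Injective P) :
    LinearIndependent F fun i => path F Γ (P i) v := by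
  classical
  obtain ⟨ε, hε, hε0⟩ := exists_functional F Γ v
  rw [linearIndependent_iff']
  intro s g hg
  by_contra! hcon
  obtain ⟨j, hj, hj0⟩ := hcon
  obtain ⟨i, hi, hmin⟩ := Finset.exists_min_image (s.filter fun i => g i ≠ 0)
    (fun i => (P i).length) ⟨j, by simp [hj, hj0]⟩
  rw [Finset.mem_filter] at hi
  have h1 : ∑ k ∈ s, g k * ε (ghostPath F Γ (P i) v * path F Γ (P k) v) = 0 := by
    have := congrArg (fun x => ε (ghostPath F Γ (P i) v * x)) hg
    simpa [Finset.mul_sum, mul_smul_comm, map_sum] using this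
  rw [Finset.sum_eq_single i, ghostPath_mul_path_self (hP i), hε, mul_one] at h1
  · exact hi.2 h1
  · intro k hk hki
    by_cases hgk : g k = 0
    · rw [hgk, zero_mul]
    have hlen := hmin k (by simp [hk, hgk])
    rcases exists_diverge (P i) (P k) with ⟨r, hr⟩ | ⟨r, hr⟩ | ⟨a, e, f, b, c, hef, h2, h3⟩
    · have hw := hP k
      rw [hr] at hw
      obtain ⟨x, hx, hx'⟩ := walk_append.1 hw
      obtain rfl := (hP i).end_unique hx
      rw [hr, ghostPath_mul_path_append (hP i) hx', hε0, mul_zero]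
      rintro rfl
      exact hki (hinj (by simpa using hr))
    · rw [hr, List.length_append] at hlen
      have : r = [] := List.length_eq_zero_iff.1 (by omega)
      exact absurd (hinj (by simpa [this] using hr)).symm hki
    · have hi' := hP i
      have hk' := hP k
      rw [h2] at hi' ⊢
      rw [h3] at hk' ⊢
      rw [ghostPath_mul_path_of_ne hef hi' hk', map_zero, mul_zero]
  · intro h
    exact absurd hi.1 h

theorem ghostPath_mul_path_of_diverge {u v w : V} {p q : List E} (h : Diverge p q)
    (hp : Γ.Walk u p v) (hq : Γ.Walk u q w) : ghostPath F Γ p v * path F Γ q w = 0 := by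
  obtain ⟨a, e, f, b, c, hef, rfl, rfl⟩ := h
  exact ghostPath_mul_path_of_ne hef hp hq

/-- The elements `p q*` for `p`, `q` in the diverging family act like matrix units: multiplying by
`(π k)*` on the left and by `π l` on the right extracts the `(k, l)` entry of a relation, which is a
relation among the `b i`. -/
theorem linearIndependent_mul {κ ι : Type*} [Fintype κ] [Fintype ι] {u w : V} {π : κ → List E}
    (hπ : ∀ k, Γ.Walk u (π k) w) (hdiv : ∀ k l, k ≠ l → Diverge (π k) (π l))
    {b : ι → Γ.Leavitt F} (hb : LinearIndependent F b) (hbl : ∀ i, vert F Γ w * b i = b i)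
    (hbr : ∀ i, b i * vert F Γ w = b i) :
    LinearIndependent F fun x : κ × κ × ι =>
      path F Γ (π x.1) w * (b x.2.2 * ghostPath F Γ (π x.2.1) w) := by
  classical
  rw [Fintype.linearIndependent_iff] at hb ⊢
  rintro g hg ⟨k, l, i⟩
  refine hb (fun i => g (k, l, i)) ?_ i
  have h1 := congrArg (fun x => ghostPath F Γ (π k) w * (x * path F Γ (π l) w)) hg
  simp only [Finset.sum_mul, Finset.mul_sum, smul_mul_assoc, mul_smul_comm, zero_mul,
    mul_zero] at h1
  have h2 : ∀ x : κ × κ × ι, g x • (ghostPath F Γ (π k) w *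
      (path F Γ (π x.1) w * (b x.2.2 * ghostPath F Γ (π x.2.1) w) * path F Γ (π l) w)) =
      if x.1 = k then (if x.2.1 = l then g x • b x.2.2 else 0) else 0 := by
    rintro ⟨k', l', j⟩
    simp only [mul_assoc]
    rw [← mul_assoc (ghostPath F Γ (π k) w)]
    by_cases hk : k' = k
    · subst hk
      rw [ghostPath_mul_path_self (hπ k'), if_pos rfl]
      by_cases hl : l' = l
      · subst hl
        rw [ghostPath_mul_path_self (hπ l'), if_pos rfl, hbr, hbl]
      · rw [ghostPath_mul_path_of_diverge (hdiv _ _ hl) (hπ _) (hπ _), if_neg hl, mul_zero,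
          mul_zero, smul_zero]
    · rw [ghostPath_mul_path_of_diverge (hdiv _ _ (Ne.symm hk)) (hπ _) (hπ _), if_neg hk,
        zero_mul, smul_zero]
  simp only [h2, Fintype.sum_prod_type] at h1
  simpa using h1

/-- Letting each of the `k` parameters run through `0, …, n` gives `(n + 1) ^ k` outer walks on each
side, of length linear in `n`, and the `P i` supply the middle factor. -/
theorem card_mul_pow_le_growth [Finite V] [Finite E] {u w : V} {k c : ℕ}
    {π : (Fin k → ℕ) → List E} (h1 : ∀ x, Γ.Walk u (π x) w)
    (h2 : ∀ x y, x ≠ y → Diverge (π x) (π y))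
    (h3 : ∀ x n, (∀ i, x i ≤ n) → (π x).length ≤ c * (n + 1)) {ι : Type*} [Fintype ι]
    {P : ι → List E} (hP : ∀ i, Γ.Walk w (P i) w) (hinj : Function.Injective P) {n N m : ℕ}
    (hN : ∀ i, (P i).length ≤ N) (hm : 2 * (c * (n + 1) + 1) + (N + 1) ≤ m) :
    (Fintype.card ι : ℝ) * ((n : ℝ) + 1) ^ (2 * k) ≤ growth (genSpan F Γ) m := by
  have := (genSpan_isGenerating (F := F) (Γ := Γ)).1
  let π' : (Fin k → Fin (n + 1)) → List E := fun x => π fun i => x i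
  have hli := linearIndependent_mul (F := F) (π := π') (fun x => h1 _)
    (fun x y hxy => h2 _ _ fun h => hxy (funext fun i => Fin.ext (congrFun h i)))
    (linearIndependent_path hP hinj) (fun i => vert_mul_path (hP i)) (fun i => path_mul_vert _ _)
  have hlen : ∀ x, (π' x).length + 1 ≤ c * (n + 1) + 1 := fun x =>
    Nat.succ_le_succ (h3 _ n fun i => Nat.lt_succ_iff.1 (x i).2)
  have hmem : ∀ x : (Fin k → Fin (n + 1)) × (Fin k → Fin (n + 1)) × ι,
      path F Γ (π' x.1) w * (path F Γ (P x.2.2) w * ghostPath F Γ (π' x.2.1) w) ∈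
        wordSpan (genSpan F Γ) m := by
    intro x
    refine wordSpan_mono _ ?_ (mul_mem_wordSpan (path_mem (hlen _))
      (mul_mem_wordSpan (path_mem (Nat.succ_le_succ (hN _))) (ghostPath_mem (hlen _))))
    omega
  have hli2 : LinearIndependent F (fun x => (⟨_, hmem x⟩ : wordSpan (genSpan F Γ) m)) :=
    LinearIndependent.of_comp (wordSpan (genSpan F Γ) m).subtype hli
  have hcard := (Nat.cast_le (α := ℝ)).2 hli2.fintype_card_le_finrank
  simp only [Fintype.card_prod, Fintype.card_pi, Fintype.card_fin, Finset.prod_const,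
    Finset.card_univ, Nat.cast_mul, Nat.cast_pow, Nat.cast_add, Nat.cast_one] at hcard
  calc _ = ((n : ℝ) + 1) ^ k * (((n : ℝ) + 1) ^ k * Fintype.card ι) := by ring
    _ ≤ _ := hcard

theorem pow_le_growth_of_fan [Finite V] [Finite E] {u w : V} {k : ℕ} (h : Γ.Fan u w k) :
    ∃ C : ℕ, 1 ≤ C ∧ ∀ n : ℕ, ((n : ℝ) + 1) ^ (2 * k) ≤ growth (genSpan F Γ) (C * (n + 1)) := by
  obtain ⟨π, c, h1, h2, h3⟩ := h
  refine ⟨2 * c + 3, by omega, fun n => ?_⟩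
  have := card_mul_pow_le_growth (F := F) h1 h2 h3 (ι := Unit) (P := fun _ => []) (n := n)
    (N := 0) (m := (2 * c + 3) * (n + 1)) (fun _ => rfl) (fun _ _ _ => rfl) (by simp) (by nlinarith)
  simpa using this

theorem pow_succ_le_growth_of_fan [Finite V] [Finite E] {u w : V} {k : ℕ} (h : Γ.Fan u w k)
    {C : Γ.Cycle} (hw : w ∈ C.verts) :
    ∃ C : ℕ, 1 ≤ C ∧
      ∀ n : ℕ, ((n : ℝ) + 1) ^ (2 * k + 1) ≤ growth (genSpan F Γ) (C * (n + 1)) := by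
  obtain ⟨π, c, h1, h2, h3⟩ := h
  obtain ⟨z, hz, hzw, -⟩ := C.exists_walk hw
  refine ⟨2 * c + 3 + z.length, by omega, fun n => ?_⟩
  have := card_mul_pow_le_growth (F := F) h1 h2 h3 (ι := Fin (n + 1)) (P := fun i => iter z i)
    (n := n) (N := n * z.length) (m := (2 * c + 3 + z.length) * (n + 1)) (fun i => hzw.iter _)
    ((iter_injective hz).comp Fin.val_injective)
    (fun i => by rw [length_iter]; exact Nat.mul_le_mul_right _ (Nat.lt_succ_iff.1 i.2))
    (by nlinarith)
  rw [Fintype.card_fin] at this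
  push_cast at this
  rwa [pow_succ, mul_comm]

/-- The lower bound for the growth of a Leavitt path algebra. -/
theorem pow_le_growth [Finite V] [Finite E] (hΓ : Γ.CyclesDisjoint)
    (hD : max (2 * Γ.maxChain - 1) (2 * Γ.maxExitChain) ≠ 0) :
    ∃ C : ℕ, 1 ≤ C ∧ ∀ n : ℕ, ((n : ℝ) + 1) ^ (max (2 * Γ.maxChain - 1) (2 * Γ.maxExitChain)) ≤
      growth (genSpan F Γ) (C * (n + 1)) := by
  rcases le_total (2 * Γ.maxChain - 1) (2 * Γ.maxExitChain) with h | h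
  · rw [max_eq_right h] at hD ⊢
    obtain ⟨l, hl, ⟨C, hC, e, hs, he⟩, hlen⟩ := Γ.exists_maxExitChain (by omega)
    obtain ⟨l, rfl⟩ := List.getLast?_eq_some_iff.1 hC
    obtain ⟨u, hu⟩ := hΓ.exists_fan hl hs (Fan.cycle hs he (fan_zero _))
    rw [← hlen, List.length_append, List.length_singleton]
    exact pow_le_growth_of_fan hu
  · rw [max_eq_left h] at hD ⊢
    obtain ⟨l, hl, hlen⟩ := Γ.exists_maxChain
    rcases List.eq_nil_or_concat' l with rfl | ⟨l, C, rfl⟩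
    · simp at hlen
      omega
    obtain ⟨v, hv⟩ := C.verts_nonempty
    obtain ⟨u, hu⟩ := hΓ.exists_fan hl hv (fan_zero v)
    have := pow_succ_le_growth_of_fan (F := F) hu hv
    rw [← hlen, List.length_append, List.length_singleton]
    exact this

/-- A word in two diverging closed walks is the path of their concatenation; unique decoding makes
these paths distinct, hence independent. -/
theorem hasFreeSubalgebra [Finite E] (hΓ : ¬ Γ.CyclesDisjoint) :
    HasFreeSubalgebra F (Γ.Leavitt F) := by
  obtain ⟨v, a, e, f, b, c, hef, h0, h1⟩ := exists_closed_walks hΓ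
  let P : Fin 2 → List E := ![a ++ e :: b, a ++ f :: c]
  have hw : ∀ i, Γ.Walk v (P i) v := Fin.forall_fin_two.2 ⟨h0, h1⟩
  have hd : Diverge (P 0) (P 1) := ⟨a, e, f, b, c, hef, rfl, rfl⟩
  have hdiv : ∀ i j, i ≠ j → Diverge (P i) (P j) := by
    simp [Fin.forall_fin_two, hd, hd.symm]
  have hne : ∀ i, P i ≠ [] := Fin.forall_fin_two.2 ⟨hd.ne_nil, hd.symm.ne_nil⟩
  refine ⟨fun i => path F Γ (P i) v, ?_⟩
  rw [liftMagma_injective_iff]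
  have hword : ∀ w : FreeSemigroup (Fin 2), FreeSemigroup.lift (fun i => path F Γ (P i) v) w =
      path F Γ ((w.head :: w.tail).flatMap P) v := by
    rintro ⟨i, t⟩
    induction t generalizing i with
    | nil =>
      have : (⟨i, []⟩ : FreeSemigroup (Fin 2)) = FreeSemigroup.of i := rfl
      simp [this]
    | cons j t ih =>
      have : (⟨i, j :: t⟩ : FreeSemigroup (Fin 2)) = FreeSemigroup.of i * ⟨j, t⟩ := rfl
      rw [this, map_mul, FreeSemigroup.lift_of, ih, ← path_append (hw i) (walk_flatMap hw _)]
      rfl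
  have := linearIndependent_path (F := F) (Γ := Γ) (v := v)
    (P := fun w : FreeSemigroup (Fin 2) => (w.head :: w.tail).flatMap P)
    (fun w => walk_flatMap hw _) fun w w' h => by
      have := flatMap_injective hne hdiv h
      rw [List.cons.injEq] at this
      exact FreeSemigroup.ext this.1 this.2
  convert this using 1
  exact funext hword

end Leavitt

end DirGraph

/-! ### Counting walks -/

namespace DirGraph

variable {V E : Type*} {Γ : DirGraph V E}

/-- The walks of length at most `n` that end at `v`. -/
def walksTo (Γ : DirGraph V E) (v : V) (n : ℕ) : Set (List E) :=
  {p | (∃ u, Γ.Walk u p v) ∧ p.length ≤ n}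

theorem walksTo_finite [Finite E] (v : V) (n : ℕ) : (Γ.walksTo v n).Finite :=
  (List.finite_length_le E n).subset fun _ h => h.2

/-- The walks of length at most `n` that end at `v`, and that are trivial or have their last edge
in `S`. -/
def walksToVia (Γ : DirGraph V E) (S : Set E) (v : V) (n : ℕ) : Set (List E) :=
  {p ∈ Γ.walksTo v n | p = [] ∨ ∃ q, ∃ e ∈ S, p = q ++ [e]}

theorem walksToVia_finite [Finite E] (S : Set E) (v : V) (n : ℕ) : (Γ.walksToVia S v n).Finite :=
  (walksTo_finite v n).subset fun _ h => h.1

/-- The number of walks of length at most `n` that end at `v` grows at most like `n ^ k`. -/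
def WalkBound (Γ : DirGraph V E) (v : V) (k : ℕ) : Prop :=
  ∃ K : ℕ, ∀ n, (Γ.walksTo v n).ncard ≤ K * (n + 1) ^ k

/-- Deleting the last edge reduces to walks to its source. Finitely many edges contribute, so the
longest of their chains dominates; `Q` carries along whatever is known about that chain. -/
theorem exists_walksToVia_bound [Finite E] {S : Set E} {Q : List Γ.Cycle → Prop} (h0 : Q [])
    (h : ∀ e ∈ S, ∃ l, Q l ∧ Γ.WalkBound (Γ.s e) l.length) :
    ∃ l, Q l ∧ ∃ K : ℕ, ∀ v n, (Γ.walksToVia S v n).ncard ≤ K * (n + 1) ^ l.length := by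
  classical
  have := Fintype.ofFinite E
  have h' : ∀ e, ∃ (l : List Γ.Cycle) (K : ℕ), Q l ∧
      (e ∈ S → ∀ n, (Γ.walksTo (Γ.s e) n).ncard ≤ K * (n + 1) ^ l.length) := by
    intro e
    by_cases he : e ∈ S
    · obtain ⟨l, hl, K, hK⟩ := h e he
      exact ⟨l, K, hl, fun _ => hK⟩
    · exact ⟨[], 0, h0, fun h => absurd h he⟩
  choose L K hQ hK using h'
  obtain ⟨l, hl, hmax⟩ : ∃ l, Q l ∧ ∀ e, (L e).length ≤ l.length := by
    rcases isEmpty_or_nonempty E with hE | hE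
    · exact ⟨[], h0, fun e => isEmptyElim e⟩
    · obtain ⟨e, he⟩ := Finite.exists_max fun e => (L e).length
      exact ⟨L e, hQ e, he⟩
  refine ⟨l, hl, 1 + ∑ e, K e, fun v n => ?_⟩
  have hsub : Γ.walksToVia S v n ⊆ {[]} ∪ ⋃ e ∈ S.toFinset,
      (fun q => q ++ [e]) '' Γ.walksTo (Γ.s e) n := by
    rintro p ⟨⟨⟨u, hu⟩, hn⟩, rfl | ⟨q, e, he, rfl⟩⟩
    · exact Or.inl rfl
    · refine Or.inr ?_
      simp only [Set.mem_iUnion]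
      rw [List.length_append] at hn
      exact ⟨e, by simpa using he, q, ⟨⟨u, (walk_concat.1 hu).1⟩, by omega⟩, rfl⟩
  have hfin : (⋃ e ∈ S.toFinset, (fun q => q ++ [e]) '' Γ.walksTo (Γ.s e) n).Finite :=
    Set.Finite.biUnion (Finset.finite_toSet _) fun e _ => (walksTo_finite _ _).image _
  calc _ ≤ _ := Set.ncard_le_ncard hsub ((Set.finite_singleton _).union hfin)
    _ ≤ 1 + ∑ e ∈ S.toFinset, ((fun q => q ++ [e]) '' Γ.walksTo (Γ.s e) n).ncard := by
        refine (Set.ncard_union_le _ _).trans ?_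
        rw [Set.ncard_singleton]
        exact Nat.add_le_add_left (Finset.set_ncard_biUnion_le _ _) 1
    _ ≤ (n + 1) ^ l.length + ∑ e ∈ S.toFinset, K e * (n + 1) ^ l.length := by
        refine Nat.add_le_add (Nat.one_le_pow _ _ n.succ_pos) (Finset.sum_le_sum fun e he => ?_)
        refine (Set.ncard_image_le (walksTo_finite _ _)).trans ((hK e (by simpa using he) n).trans ?_)
        exact Nat.mul_le_mul_left _ (Nat.pow_le_pow_right n.succ_pos (hmax e))
    _ ≤ (n + 1) ^ l.length + ∑ e, K e * (n + 1) ^ l.length :=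
        Nat.add_le_add_left (Finset.sum_le_sum_of_subset (Finset.subset_univ _)) _
    _ = _ := by rw [← Finset.sum_mul, add_mul, one_mul]

/-- The edges that enter the cycle `C` from outside. -/
def Cycle.entering (C : Γ.Cycle) : Set E := {e | Γ.r e ∈ C.verts ∧ Γ.s e ∉ C.verts}

/-- The chain `l` of cycles, all of which reach `v`, bounds the number of walks to `v`. -/
def ChainBound (Γ : DirGraph V E) (v : V) (l : List Γ.Cycle) : Prop :=
  Γ.IsCycleChain l ∧ (∀ C ∈ l, ∃ u ∈ C.verts, Γ.Reach u v) ∧ Γ.WalkBound v l.length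

theorem Cycle.exists_range_eq (C : Γ.Cycle) {v : V} (hv : v ∈ C.verts) :
    ∃ e ∈ C.edges, Γ.r e = v := by
  obtain ⟨p, -, hw, -, hV, hE⟩ := C.exists_walk hv
  have h := (List.perm_cons _).1 hw.perm
  have hv' : v ∈ p.map Γ.s := by rw [hV] at hv; exact hv
  obtain ⟨e, he, rfl⟩ := List.mem_map.1 (h.mem_iff.2 hv')
  exact ⟨e, by rw [hE]; exact he, rfl⟩

theorem CyclesDisjoint.mem_edges_of_source (hΓ : Γ.CyclesDisjoint) {C : Γ.Cycle} {e : E}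
    (hs : Γ.s e ∈ C.verts) (hr : Γ.r e ∈ C.verts) : e ∈ C.edges :=
  hΓ.mem_edges (p := [e]) hs hr ⟨rfl, rfl⟩ (Reach.refl _) e (by simp)

/-- A chain reaching the source of an entering edge cannot contain `C`, since that source would then
lie between two vertices of `C`, hence on `C`. So `C` may be appended to it. -/
theorem CyclesDisjoint.exists_entering_bound [Finite E] (hΓ : Γ.CyclesDisjoint) {C : Γ.Cycle}
    (h : ∀ e ∈ C.entering, ∃ l, Γ.ChainBound (Γ.s e) l) :
    ∃ l, Γ.IsCycleChain (l ++ [C]) ∧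
      (∀ D ∈ l ++ [C], ∃ u ∈ D.verts, ∃ w ∈ C.verts, Γ.Reach u w) ∧
      ∃ K : ℕ, ∀ v n, (Γ.walksToVia C.entering v n).ncard ≤ K * (n + 1) ^ l.length := by
  obtain ⟨v, hv⟩ := C.verts_nonempty
  obtain ⟨l, ⟨hl, hl'⟩, hK⟩ := exists_walksToVia_bound (S := C.entering)
    (Q := fun l => Γ.IsCycleChain (l ++ [C]) ∧
      ∀ D ∈ l ++ [C], ∃ u ∈ D.verts, ∃ w ∈ C.verts, Γ.Reach u w)
    ⟨⟨by simp, by simp⟩, by simpa using ⟨v, hv, v, hv, Reach.refl v⟩⟩ (by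
      rintro e ⟨hr, hs⟩
      obtain ⟨l, ⟨hnd, hch⟩, hreach, hb⟩ := h e ⟨hr, hs⟩
      have hCl : ∀ D ∈ l, D ≠ C := by
        rintro D hD rfl
        obtain ⟨u, hu, hu'⟩ := hreach D hD
        exact hs (hΓ.mem_verts hu hr hu' (Reach.of_edge e))
      refine ⟨l, ⟨⟨?_, ?_⟩, ?_⟩, hb⟩
      · rw [List.nodup_append]
        refine ⟨hnd, by simp, fun D hD D' hD' => ?_⟩
        rw [List.mem_singleton.1 hD']
        exact hCl D hD
      · rw [List.isChain_append]
        refine ⟨hch, by simp, fun D hD D' hD' => ?_⟩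
        have hD1 := List.mem_of_mem_getLast? hD
        obtain rfl : C = D' := by simpa using hD'
        obtain ⟨u, hu, hu'⟩ := hreach D hD1
        exact hΓ.reaches (hCl D hD1) hu hr (hu'.trans (Reach.of_edge e))
      · intro D hD
        rcases List.mem_append.1 hD with hD | hD
        · obtain ⟨u, hu, hu'⟩ := hreach D hD
          exact ⟨u, hu, _, hr, hu'.trans (Reach.of_edge e)⟩
        · rw [List.mem_singleton.1 hD]
          exact ⟨v, hv, v, hv, Reach.refl v⟩)
  exact ⟨l, hl, hl', hK⟩

/-- Either the walk is trivial or has just entered `C`, or its last edge is the unique edge of `C`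
into `v`, whose removal gives a walk to the preceding vertex, shorter by one. Summing over the steps
back costs one power of `n + 1`. -/
theorem CyclesDisjoint.walkBound_of_entering [Finite E] (hΓ : Γ.CyclesDisjoint) {C : Γ.Cycle}
    {K k : ℕ} (h : ∀ v n, (Γ.walksToVia C.entering v n).ncard ≤ K * (n + 1) ^ k) {v : V}
    (hv : v ∈ C.verts) (n : ℕ) : (Γ.walksTo v n).ncard ≤ K * (n + 1) ^ (k + 1) := by
  induction n generalizing v with
  | zero =>
    have : Γ.walksTo v 0 ⊆ Γ.walksToVia C.entering v 0 := fun p hp =>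
      ⟨hp, Or.inl (List.length_eq_zero_iff.1 (Nat.le_zero.1 hp.2))⟩
    refine (Set.ncard_le_ncard this (walksToVia_finite _ _ _)).trans ((h v 0).trans ?_)
    simp
  | succ n ih =>
    obtain ⟨c, hc, hcv⟩ := C.exists_range_eq hv
    have hsub : Γ.walksTo v (n + 1) ⊆
        Γ.walksToVia C.entering v (n + 1) ∪ (fun q => q ++ [c]) '' Γ.walksTo (Γ.s c) n := by
      rintro p ⟨⟨u, hu⟩, hn⟩
      rcases List.eq_nil_or_concat' p with rfl | ⟨q, e, rfl⟩
      · exact Or.inl ⟨⟨⟨u, hu⟩, hn⟩, Or.inl rfl⟩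
      · obtain ⟨h1, h2⟩ := walk_concat.1 hu
        by_cases hs : Γ.s e ∈ C.verts
        · have he := hΓ.mem_edges_of_source hs (h2 ▸ hv)
          obtain rfl := C.eq_of_range_eq he hc (h2.trans hcv.symm)
          rw [List.length_append, List.length_singleton] at hn
          exact Or.inr ⟨q, ⟨⟨u, h1⟩, by omega⟩, rfl⟩
        · exact Or.inl ⟨⟨⟨u, hu⟩, hn⟩, Or.inr ⟨q, e, ⟨h2 ▸ hv, hs⟩, rfl⟩⟩
    calc _ ≤ _ := Set.ncard_le_ncard hsub
          ((walksToVia_finite _ _ _).union ((walksTo_finite _ _).image _))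
      _ ≤ _ := Set.ncard_union_le _ _
      _ ≤ K * (n + 1 + 1) ^ k + K * (n + 1) ^ (k + 1) := Nat.add_le_add (h v (n + 1))
          ((Set.ncard_image_le (walksTo_finite _ _)).trans (ih (C.source_mem hc)))
      _ ≤ K * (n + 1 + 1) ^ k + K * ((n + 1 + 1) ^ k * (n + 1)) := by
          rw [pow_succ]
          gcongr
          omega
      _ = _ := by ring

theorem CyclesDisjoint.exists_chainBound [Finite V] [Finite E] (hΓ : Γ.CyclesDisjoint) (v : V) :
    ∃ l, Γ.ChainBound v l := by
  induction hN : {u | Γ.Reach u v}.ncard using Nat.strong_induction_on generalizing v with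
  -- The induction is on the number of vertices that reach `v`; it drops strictly on passing to a
  -- vertex that reaches `v` but is not reached from `v`.
  | _ N ih =>
    have hlt : ∀ w, Γ.Reach w v → ¬ Γ.Reach v w → ∃ l, Γ.ChainBound w l := by
      intro w hw hv
      refine ih _ ?_ w rfl
      rw [← hN]
      exact Set.ncard_lt_ncard ⟨fun u hu => hu.trans hw, fun h => hv (h (Reach.refl v))⟩
        (Set.toFinite _)
    by_cases hC : ∃ C : Γ.Cycle, v ∈ C.verts
    · obtain ⟨C, hC⟩ := hC
      obtain ⟨l, hl, hreach, K, hK⟩ := hΓ.exists_entering_bound (C := C) (by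
        rintro e ⟨hr, hs⟩
        refine hlt _ ((Reach.of_edge e).trans (C.reach hr hC)) fun h => hs ?_
        exact hΓ.mem_verts hC hr h (Reach.of_edge e))
      refine ⟨l ++ [C], hl, fun D hD => ?_, K, fun n => ?_⟩
      · obtain ⟨u, hu, w, hw, huw⟩ := hreach D hD
        exact ⟨u, hu, huw.trans (C.reach hw hC)⟩
      · rw [List.length_append, List.length_singleton]
        exact hΓ.walkBound_of_entering hK hC n
    · obtain ⟨l, ⟨hl, hreach⟩, K, hK⟩ := exists_walksToVia_bound (S := {e | Γ.r e = v})
        (Q := fun l => Γ.IsCycleChain l ∧ ∀ C ∈ l, ∃ u ∈ C.verts, Γ.Reach u v)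
        ⟨⟨by simp, by simp⟩, by simp⟩ (by
          rintro e rfl
          obtain ⟨l, hl, hreach, hb⟩ := hlt _ (Reach.of_edge e) (by
            rintro ⟨p, hp⟩
            exact hC ((walk_concat (e := e)).2 ⟨hp, rfl⟩ |>.exists_cycle_mem (by simp)))
          refine ⟨l, ⟨hl, fun C hC => ?_⟩, hb⟩
          obtain ⟨u, hu, hu'⟩ := hreach C hC
          exact ⟨u, hu, hu'.trans (Reach.of_edge e)⟩)
      refine ⟨l, hl, hreach, K, fun n => ?_⟩
      refine (Set.ncard_le_ncard (fun p hp => ?_) (walksToVia_finite _ _ _)).trans (hK v n)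
      refine ⟨hp, ?_⟩
      obtain ⟨⟨u, hu⟩, -⟩ := hp
      rcases List.eq_nil_or_concat' p with rfl | ⟨q, e, rfl⟩
      · exact Or.inl rfl
      · exact Or.inr ⟨q, e, (walk_concat.1 hu).2, rfl⟩

/-- The pairs `(p, q)` of walks of length at most `n` to `v` for which `p q*` cannot be shortened
by a relation `e e* = s(e)`. -/
def reducedPairs (Γ : DirGraph V E) (v : V) (n : ℕ) : Set (List E × List E) :=
  {x | x.1 ∈ Γ.walksTo v n ∧ x.2 ∈ Γ.walksTo v n ∧
    ¬ ∃ p q e, x.1 = p ++ [e] ∧ x.2 = q ++ [e] ∧ ∀ f, Γ.s f = Γ.s e → f = e}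

theorem reducedPairs_finite [Finite E] (v : V) (n : ℕ) : (Γ.reducedPairs v n).Finite :=
  ((walksTo_finite v n).prod (walksTo_finite v n)).subset fun _ h => ⟨h.1, h.2.1⟩

/-- If both walks ended along `C`, they would share the unique edge of `C` into `v`. As `C` has no
exit, this is the only edge with its source, so the pair would not be reduced. -/
theorem CyclesDisjoint.reducedPairs_subset (hΓ : Γ.CyclesDisjoint) {C : Γ.Cycle}
    (hC : ¬ C.HasExit) {v : V} (hv : v ∈ C.verts) (n : ℕ) :
    Γ.reducedPairs v n ⊆ Γ.walksToVia C.entering v n ×ˢ Γ.walksTo v n ∪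
      Γ.walksTo v n ×ˢ Γ.walksToVia C.entering v n := by
  rintro ⟨p, q⟩ ⟨hp, hq, hred⟩
  have key : ∀ p ∈ Γ.walksTo v n, p ∈ Γ.walksToVia C.entering v n ∨
      ∃ p' e, p = p' ++ [e] ∧ e ∈ C.edges ∧ Γ.r e = v := by
    intro p hp
    obtain ⟨⟨u, hu⟩, hn⟩ := id hp
    rcases List.eq_nil_or_concat' p with rfl | ⟨p', e, rfl⟩
    · exact Or.inl ⟨hp, Or.inl rfl⟩
    · have hr := (walk_concat.1 hu).2
      by_cases hs : Γ.s e ∈ C.verts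
      · exact Or.inr ⟨p', e, rfl, hΓ.mem_edges_of_source hs (hr ▸ hv), hr⟩
      · exact Or.inl ⟨hp, Or.inr ⟨p', e, ⟨hr ▸ hv, hs⟩, rfl⟩⟩
  rcases key p hp with h1 | ⟨p', e, h1, he, her⟩
  · exact Or.inl ⟨h1, hq⟩
  rcases key q hq with h2 | ⟨q', f, h2, hf, hfr⟩
  · exact Or.inr ⟨hp, h2⟩
  obtain rfl := C.eq_of_range_eq he hf (her.trans hfr.symm)
  refine absurd ⟨p', q', e, h1, h2, fun f hf => ?_⟩ hred
  have hfC : f ∈ C.edges := by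
    by_contra h
    exact hC ⟨f, hf ▸ C.source_mem he, h⟩
  exact C.eq_of_source_eq hfC he hf

theorem CyclesDisjoint.exists_reducedPairs_bound [Finite V] [Finite E] (hΓ : Γ.CyclesDisjoint)
    (v : V) : ∃ K : ℕ, ∀ n, (Γ.reducedPairs v n).ncard ≤
      K * (n + 1) ^ (max (2 * Γ.maxChain - 1) (2 * Γ.maxExitChain)) := by
  obtain ⟨l, hl, hreach, K, hK⟩ := hΓ.exists_chainBound v
  by_cases hexit : l.length ≤ Γ.maxExitChain
  · refine ⟨K * K, fun n => ?_⟩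
    calc _ ≤ (Γ.walksTo v n ×ˢ Γ.walksTo v n).ncard :=
          Set.ncard_le_ncard (fun _ h => ⟨h.1, h.2.1⟩) ((walksTo_finite v n).prod (walksTo_finite v n))
      _ = (Γ.walksTo v n).ncard * (Γ.walksTo v n).ncard := Set.ncard_prod
      _ ≤ (K * (n + 1) ^ l.length) * (K * (n + 1) ^ l.length) := Nat.mul_le_mul (hK n) (hK n)
      _ = K * K * (n + 1) ^ (2 * l.length) := by ring
      _ ≤ _ := Nat.mul_le_mul_left _ (Nat.pow_le_pow_right n.succ_pos
          (le_max_of_le_right (by omega)))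
  · rcases List.eq_nil_or_concat' l with rfl | ⟨l, C, rfl⟩
    · simp at hexit
    -- The chain is too long to have an exit; its last cycle reaches `v` but cannot be left, which
    -- forces `v` onto `C`.
    have hC : ¬ C.HasExit := fun h => hexit (hl.length_le_of_exit ⟨C, by simp, h⟩)
    have hv : v ∈ C.verts := by
      by_contra hv
      obtain ⟨u, hu, p, hp⟩ := hreach C (by simp)
      obtain ⟨e, hs, he, -⟩ := hp.exists_leaving_edge hu hv
      exact hC ⟨e, hs, he⟩
    -- A fresh chain through `C` bounds the entering walks separately: exponent `m.length` for them
    -- and `m.length + 1` for all walks to `v`, with `m.length + 1 ≤ Γ.maxChain`.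
    obtain ⟨m, hm, -, K, hK⟩ := hΓ.exists_entering_bound (C := C) fun e _ =>
      hΓ.exists_chainBound (Γ.s e)
    have hlen := hm.length_le
    rw [List.length_append, List.length_singleton] at hlen
    refine ⟨2 * (K * K), fun n => ?_⟩
    have h1 := hK v n
    have h2 := hΓ.walkBound_of_entering hK hv n
    have hfin1 := walksTo_finite (Γ := Γ) v n
    have hfin2 := walksToVia_finite (Γ := Γ) C.entering v n
    calc _ ≤ _ := Set.ncard_le_ncard (hΓ.reducedPairs_subset hC hv n)
          ((hfin2.prod hfin1).union (hfin1.prod hfin2))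
      _ ≤ _ := Set.ncard_union_le _ _
      _ = (Γ.walksToVia C.entering v n).ncard * (Γ.walksTo v n).ncard +
          (Γ.walksTo v n).ncard * (Γ.walksToVia C.entering v n).ncard := by
          rw [Set.ncard_prod, Set.ncard_prod]
      _ ≤ (K * (n + 1) ^ m.length) * (K * (n + 1) ^ (m.length + 1)) +
          (K * (n + 1) ^ (m.length + 1)) * (K * (n + 1) ^ m.length) :=
          Nat.add_le_add (Nat.mul_le_mul h1 h2) (Nat.mul_le_mul h2 h1)
      _ = 2 * (K * K) * (n + 1) ^ (2 * m.length + 1) := by ring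
      _ ≤ _ := Nat.mul_le_mul_left _ (Nat.pow_le_pow_right n.succ_pos
          (le_max_of_le_left (by omega)))

/-! ### Spanning monomials -/

namespace Leavitt

variable {F : Type*} [Field F]

/-- The products `p q*` with `p` and `q` of length at most `n`. -/
def monomials (F : Type*) [Field F] (Γ : DirGraph V E) (n : ℕ) : Set (Γ.Leavitt F) :=
  {x | ∃ v, ∃ p ∈ Γ.walksTo v n, ∃ q ∈ Γ.walksTo v n, x = path F Γ p v * ghostPath F Γ q v}

theorem walksTo_mono (v : V) : Monotone (Γ.walksTo v) := fun _ _ h _ hp => ⟨hp.1, hp.2.trans h⟩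

theorem monomials_mono : Monotone (monomials F Γ) := by
  rintro m n h x ⟨v, p, hp, q, hq, rfl⟩
  exact ⟨v, p, walksTo_mono v h hp, q, walksTo_mono v h hq, rfl⟩

theorem path_singleton (e : E) : path F Γ [e] (Γ.r e) = edge F Γ e := edge_mul_range e

theorem ghostPath_singleton (e : E) : ghostPath F Γ [e] (Γ.r e) = ghost F Γ e :=
  range_mul_ghost e

theorem nil_mem_walksTo (v : V) (n : ℕ) : [] ∈ Γ.walksTo v n := ⟨⟨v, rfl⟩, Nat.zero_le _⟩

theorem singleton_mem_walksTo (e : E) : [e] ∈ Γ.walksTo (Γ.r e) 1 := ⟨⟨_, rfl, rfl⟩, le_rfl⟩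

theorem gen_mem_monomials (g : Gen V E) : gen F Γ g ∈ monomials F Γ 1 := by
  cases g with
  | vert v =>
    exact ⟨v, [], nil_mem_walksTo v 1, [], nil_mem_walksTo v 1, (vert_mul_self v).symm⟩
  | edge e =>
    refine ⟨Γ.r e, [e], singleton_mem_walksTo e, [], nil_mem_walksTo _ 1, ?_⟩
    rw [path_singleton, ghostPath_nil, edge_mul_range]
    rfl
  | ghost e =>
    refine ⟨Γ.r e, [], nil_mem_walksTo _ 1, [e], singleton_mem_walksTo e, ?_⟩
    rw [ghostPath_singleton, path_nil, range_mul_ghost]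
    rfl

/-- Left multiplication suffices because `wordSpan` is built by multiplying on the left. A generator
lengthens `p`, cancels its first edge, lengthens `q` when `p` is trivial, or acts as the identity or
zero. -/
theorem gen_mul_mem_span_monomials {n : ℕ} (g : Gen V E) {x : Γ.Leavitt F}
    (hx : x ∈ monomials F Γ n) : gen F Γ g * x ∈ Submodule.span F (monomials F Γ (n + 1)) := by
  obtain ⟨v, p, ⟨⟨u, hu⟩, hpn⟩, q, ⟨⟨t, ht⟩, hqn⟩, rfl⟩ := id hx
  rw [← mul_assoc]
  have hq : q ∈ Γ.walksTo v (n + 1) := ⟨⟨t, ht⟩, hqn.trans n.le_succ⟩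
  cases g with
  | vert w =>
    change vert F Γ w * _ * _ ∈ _
    by_cases hw : w = u
    · rw [hw, vert_mul_path hu]
      exact Submodule.subset_span (monomials_mono n.le_succ hx)
    · rw [vert_mul_path_of_ne hu hw, zero_mul]
      exact zero_mem _
  | edge e =>
    change edge F Γ e * _ * _ ∈ _
    by_cases he : Γ.r e = u
    · exact Submodule.subset_span ⟨v, e :: p,
        ⟨⟨Γ.s e, rfl, he ▸ hu⟩, Nat.succ_le_succ hpn⟩, q, hq, rfl⟩
    · rw [← edge_mul_range, mul_assoc (edge F Γ e), vert_mul_path_of_ne hu he, mul_zero, zero_mul]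
      exact zero_mem _
  | ghost e =>
    change ghost F Γ e * _ * _ ∈ _
    cases p with
    | nil =>
      obtain rfl := walk_nil.1 hu
      rw [path_nil, mul_assoc, vert_mul_ghostPath]
      by_cases he : Γ.s e = u
      · subst he
        refine Submodule.subset_span ⟨Γ.r e, [], nil_mem_walksTo _ _, q ++ [e],
          ⟨⟨t, walk_concat.2 ⟨ht, rfl⟩⟩, ?_⟩, ?_⟩
        · rw [List.length_append]
          exact Nat.succ_le_succ hqn
        · rw [path_nil, vert_mul_ghostPath, ghostPath_append ht (walk_edge e), ghostPath_singleton]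
      · rw [← ghost_mul_source, ← vert_mul_ghostPath, mul_assoc, ← mul_assoc (vert F Γ (Γ.s e)),
          vert_mul_of_ne he, zero_mul, mul_zero]
        exact zero_mem _
    | cons f p =>
      rw [path_cons, ← mul_assoc (ghost F Γ e)]
      by_cases hef : e = f
      · subst hef
        rw [ghost_mul_edge_self, vert_mul_path hu.2]
        refine Submodule.subset_span ⟨v, p, ⟨⟨_, hu.2⟩, ?_⟩, q, hq, rfl⟩
        simp only [List.length_cons] at hpn
        omega
      · rw [ghost_mul_edge_of_ne hef, zero_mul, zero_mul]
        exact zero_mem _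

theorem wordSpan_le_span_monomials (n : ℕ) :
    wordSpan (genSpan F Γ) n ≤ Submodule.span F (monomials F Γ n) := by
  induction n with
  | zero => exact bot_le
  | succ n ih =>
    rw [wordSpan_succ]
    refine sup_le ?_ ?_
    · rw [genSpan, Submodule.span_le]
      rintro _ ⟨g, rfl⟩
      exact Submodule.subset_span (monomials_mono (Nat.le_add_left 1 n) (gen_mem_monomials g))
    · refine (Submodule.map₂_le_map₂_right ih).trans ?_
      rw [genSpan, Submodule.map₂_span_span, Submodule.span_le]
      rintro _ ⟨_, ⟨g, rfl⟩, x, hx, rfl⟩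
      exact gen_mul_mem_span_monomials g hx

/-- If the last edge is common to both walks and is the only edge with its source, `e e* = s(e)`
removes it from both; repeat until the pair is reduced. -/
theorem monomial_mem_reduced {n : ℕ} {v : V} {p q : List E} (hp : p ∈ Γ.walksTo v n)
    (hq : q ∈ Γ.walksTo v n) :
    ∃ w, ∃ x ∈ Γ.reducedPairs w n,
      path F Γ p v * ghostPath F Γ q v = path F Γ x.1 w * ghostPath F Γ x.2 w := by
  induction hl : p.length generalizing p q v with
  | zero =>
    refine ⟨v, (p, q), ⟨hp, hq, ?_⟩, rfl⟩
    rintro ⟨p', q', e, h, -⟩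
    simp [show p = p' ++ [e] from h] at hl
  | succ k ih =>
    by_cases h : ∃ p' q' e, p = p' ++ [e] ∧ q = q' ++ [e] ∧ ∀ f, Γ.s f = Γ.s e → f = e
    · obtain ⟨p', q', e, rfl, rfl, he⟩ := h
      obtain ⟨⟨u, hu⟩, hpn⟩ := hp
      obtain ⟨⟨t, ht⟩, hqn⟩ := hq
      obtain ⟨hu', rfl⟩ := walk_concat.1 hu
      obtain ⟨ht', -⟩ := walk_concat.1 ht
      simp only [List.length_append, List.length_singleton] at hpn hqn hl
      obtain ⟨w, x, hx, h⟩ := ih (p := p') (q := q') (v := Γ.s e) ⟨⟨u, hu'⟩, by omega⟩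
        ⟨⟨t, ht'⟩, by omega⟩ (by omega)
      refine ⟨w, x, hx, ?_⟩
      rw [← h, path_append hu' (walk_edge e), ghostPath_append ht' (walk_edge e), path_singleton,
        ghostPath_singleton, mul_assoc, ← mul_assoc (edge F Γ e), edge_mul_ghost he,
        vert_mul_ghostPath]
    · exact ⟨v, (p, q), ⟨hp, hq, h⟩, rfl⟩

/-- The upper bound for the growth of a Leavitt path algebra. -/
theorem growth_le_pow [Finite V] [Finite E] (hΓ : Γ.CyclesDisjoint) :
    ∃ K : ℝ, ∀ n : ℕ, growth (genSpan F Γ) n ≤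
      K * ((n : ℝ) + 1) ^ (max (2 * Γ.maxChain - 1) (2 * Γ.maxExitChain)) := by
  classical
  have := Fintype.ofFinite V
  choose K hK using hΓ.exists_reducedPairs_bound
  refine ⟨(∑ v, K v : ℕ), fun n => ?_⟩
  let T : Finset (Γ.Leavitt F) := Finset.univ.biUnion fun v =>
    (reducedPairs_finite (Γ := Γ) v n).toFinset.image fun x =>
      path F Γ x.1 v * ghostPath F Γ x.2 v
  have hspan : wordSpan (genSpan F Γ) n ≤ Submodule.span F (T : Set (Γ.Leavitt F)) := by
    refine (wordSpan_le_span_monomials n).trans (Submodule.span_mono ?_)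
    rintro _ ⟨v, p, hp, q, hq, rfl⟩
    obtain ⟨w, x, hx, h⟩ := monomial_mem_reduced (F := F) hp hq
    rw [h]
    simp only [T, Finset.coe_biUnion, Set.mem_iUnion, Finset.coe_image]
    exact ⟨w, by simp, x, by simpa using hx, rfl⟩
  have hcard : T.card ≤ (∑ v, K v) *
      (n + 1) ^ (max (2 * Γ.maxChain - 1) (2 * Γ.maxExitChain)) := by
    refine Finset.card_biUnion_le.trans ?_
    rw [Finset.sum_mul]
    refine Finset.sum_le_sum fun v _ => Finset.card_image_le.trans ?_
    rw [← Set.ncard_eq_toFinset_card _ (reducedPairs_finite v n)]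
    exact hK v n
  have := ((Submodule.finrank_mono hspan).trans (finrank_span_finset_le_card T)).trans hcard
  simpa [growth] using (Nat.cast_le (α := ℝ)).2 this

end Leavitt

end DirGraph

theorem theorem2 {F V E : Type*} [Field F] [Finite V] [Finite E] (Γ : DirGraph V E) :
    (HasPolynomialGrowth F (Γ.Leavitt F) ↔ Γ.CyclesDisjoint) ∧
    (¬ Γ.CyclesDisjoint →
      HasFreeSubalgebra F (Γ.Leavitt F) ∧ HasExponentialGrowth F (Γ.Leavitt F)) ∧
    (Γ.CyclesDisjoint →
      HasGKDim F (Γ.Leavitt F)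
        ((max (2 * (Γ.maxChain : ℝ) - 1) (2 * (Γ.maxExitChain : ℝ)) : ℝ) : EReal)) := by
  have hgen := DirGraph.Leavitt.genSpan_isGenerating (F := F) (Γ := Γ)
  have hexp : ¬ Γ.CyclesDisjoint →
      HasFreeSubalgebra F (Γ.Leavitt F) ∧ HasExponentialGrowth F (Γ.Leavitt F) := fun h =>
    ⟨DirGraph.Leavitt.hasFreeSubalgebra h,
      (DirGraph.Leavitt.hasFreeSubalgebra h).hasExponentialGrowth hgen⟩
  refine ⟨⟨fun h => ?_, fun h => ?_⟩, hexp, fun h => ?_⟩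
  · by_contra hΓ
    exact (hexp hΓ).2.not_hasPolynomialGrowth h
  · obtain ⟨K, hK⟩ := DirGraph.Leavitt.growth_le_pow (F := F) h
    exact hgen.hasPolynomialGrowth hK
  · obtain ⟨K, hK⟩ := DirGraph.Leavitt.growth_le_pow (F := F) h
    -- Real and truncated subtraction disagree only when there are no cycles; then both maxima are
    -- `0`, thanks to the second term.
    have hcast : max (2 * (Γ.maxChain : ℝ) - 1) (2 * (Γ.maxExitChain : ℝ)) =
        ((max (2 * Γ.maxChain - 1) (2 * Γ.maxExitChain) : ℕ) : ℝ) := by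
      have hle := Γ.maxExitChain_le_maxChain
      rcases Nat.eq_zero_or_pos Γ.maxChain with h0 | h0
      · have h1 : Γ.maxExitChain = 0 := by omega
        simp [h0, h1]
      · rw [Nat.cast_max, Nat.cast_sub (by omega)]
        push_cast
        rfl
    rw [hcast]
    refine hgen.hasGKDim hK ?_
    by_cases hD : max (2 * Γ.maxChain - 1) (2 * Γ.maxExitChain) = 0
    · exact Or.inl hD
    · exact Or.inr (DirGraph.Leavitt.pow_le_growth h hD)
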